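/- Let $\xi_0,\xi_1,\xi_2,\dots$ be a stationary sequence of real random variables on a probability space $(\Omega,\mathcal F,P)$, and let $Q$ be the distribution of $\xi_0$. For $\sigma$-algebras $\mathcal G,\mathcal H\subset\mathcal F$ put $$\psi(\mathcal G,\mathcal H)=\sup\Big\{\Big|\frac{P(A\cap B)}{P(A)P(B)}-1\Big|:\ A\in\mathcal G,\ B\in\mathcal H,\ P(A)P(B)\neq 0\Big\},$$ and $\psi(n)=\sup_{m\ge 0}\psi\big(\sigma(\xi_0,\dots,\xi_m),\,\sigma(\xi_{m+n},\xi_{m+n+1},\dots)\big)$. Assume that the sequence is $\psi$-mixing, i.e. $\psi(1)<\infty$ and $\psi(n)\to 0$ as $n\to\infty$. Let $\ell\ge 1$ and let $q_1,\dots,q_\ell:\mathbb N\to\mathbb N$ (where $\mathbb N=\{0,1,2,\dots\}$) be strictly increasing functions with $q_1(n)<q_2(n)<\dots<q_\ell(n)$ for all $n\ge 0$ and $q_{i+1}(n)-q_i(n)\to\infty$ as $n\to\infty$ for each $1\le i\le\ell-1$. Let $(\Gamma_N,\Delta_N)$, $N=1,2,\dots$, be pairs of disjoint Borel subsets of $\mathbb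 R$ of positive $Q$-measure such that $Q(\Gamma_N)\to 0$ and $Q(\Delta_N)\to 0$ as $N\to\infty$ and, for some constant $C>0$, $$C^{-1}\le\frac{Q(\Gamma_N)}{Q(\Delta_N)}\le C\qquad\text{for all }N.$$ Set $X^{(N)}_{n,0}=\prod_{i=1}^{\ell}\mathbb 1_{\Gamma_N}(\xi_{q_i(n)})$, $X^{(N)}_{n,1}=\prod_{i=1}^{\ell}\mathbb 1_{\Delta_N}(\xi_{q_i(n)})$, $$\tau_N=\min\{n\ge 0:\ X^{(N)}_{n,0}=1\}\quad(\tau_N=\infty\text{ if there is no such }n),\qquad S^{(N)}_M=\sum_{0\le n<M}X^{(N)}_{n,1}\quad (M\in\mathbb N\cup\{\infty\}),$$ so that $S^{(N)}_{\tau_N}$ takes values in $\mathbb N\cup\{\infty\}$. Let $\mathcal L(Y)$ denote the law of $Y$, let $d_{TV}(\mu,\nu)=\sup_G|\mu(G)-\nu(G)|$, the supremum being over measurable sets, and for $\rho\in(0,1)$ let $\mathrm{Geo}(\rho)$ be the distribution with $\mathrm{Geo}(\rho)\{k\}=\rho(1-\rho)^k$, $k=0,1,2,\dots$. Then $$d_{TV}\big(\mathcal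 L(S^{(N)}_{\tau_N}),\,\mathrm{Geo}(\rho_N)\big)\to 0\quad\text{as }N\to\infty,\qquad \rho_N=\frac{Q(\Gamma_N)^\ell}{Q(\Gamma_N)^\ell+Q(\Delta_N)^\ell}.$$ If moreover $Q(\Delta_N)/Q(\Gamma_N)\to\lambda$ as $N\to\infty$, then $$d_{TV}\big(\mathcal L(S^{(N)}_{\tau_N}),\,\mathrm{Geo}((1+\lambda^\ell)^{-1})\big)\to 0\quad\text{as }N\to\infty.$$ -/

import Mathlib

open MeasureTheory Filter Topology
open scoped ENNReal

noncomputable section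

namespace MultipleReturns

/-- The total variation distance `sup_G |μ(G) - ν(G)|` over all measurable sets `G`. -/
def tvDist {E : Type*} [MeasurableSpace E] (μ ν : Measure E) : ℝ :=
  ⨆ G : {G : Set E // MeasurableSet G}, |μ.real G.1 - ν.real G.1|

/-- The geometric distribution with parameter `ρ ∈ (0, 1)`, giving mass `ρ (1 - ρ) ^ k` to each
`k = 0, 1, 2, …`, viewed as a measure on `ℕ∞ = ℕ ∪ {∞}` with no mass at `∞`. Mathlib's geometric
measure takes its parameter in the type of points of `[0, 1]`, hence the projection, which is
the identity on `[0, 1]`. -/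
def geo (ρ : ℝ) : Measure ℕ∞ :=
  (ProbabilityTheory.geometricMeasure (Set.projIcc 0 1 zero_le_one ρ)).map (fun k : ℕ => (k : ℕ∞))

theorem geo_singleton {ρ : ℝ} (h0 : 0 < ρ) (h1 : ρ < 1) (k : ℕ) :
    geo ρ {(k : ℕ∞)} = ENNReal.ofReal (ρ * (1 - ρ) ^ k) := by
  have hp : Set.projIcc (0 : ℝ) 1 zero_le_one ρ = ⟨ρ, h0.le, h1.le⟩ :=
    Set.projIcc_of_mem zero_le_one ⟨h0.le, h1.le⟩
  have hne : Set.projIcc (0 : ℝ) 1 zero_le_one ρ ≠ 0 := by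
    rw [hp]
    intro h
    exact h0.ne' (congrArg Subtype.val h)
  have hpre : (fun k : ℕ => (k : ℕ∞)) ⁻¹' {(k : ℕ∞)} = {k} := by
    ext j
    simp
  rw [geo, Measure.map_apply (measurable_of_countable _) (MeasurableSet.singleton _), hpre,
    ProbabilityTheory.geometricMeasure_singleton hne, hp, mul_comm]

instance isProbabilityMeasure_geo (ρ : ℝ) : IsProbabilityMeasure (geo ρ) :=
  Measure.isProbabilityMeasure_map (measurable_of_countable _).aemeasurable

/-- The `ψ`-dependence coefficient of two `σ`-algebras `𝒢` and `ℋ`: the supremum of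
`|P(A ∩ B) / (P(A) P(B)) - 1|` over `A ∈ 𝒢`, `B ∈ ℋ` with `P(A) P(B) ≠ 0`, a value in `[0, ∞]`. -/
def psiCoeff {Ω : Type*} [MeasurableSpace Ω] (P : Measure Ω) (𝒢 ℋ : MeasurableSpace Ω) :
    ℝ≥0∞ :=
  ⨆ (A : Set Ω) (B : Set Ω) (_ : MeasurableSet[𝒢] A) (_ : MeasurableSet[ℋ] B)
    (_ : P A * P B ≠ 0), ENNReal.ofReal |P.real (A ∩ B) / (P.real A * P.real B) - 1|

/-- The `σ`-algebra generated by the random variables `ξ k`, `k ∈ I`. -/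
abbrev sigmaOf {Ω : Type*} (ξ : ℕ → Ω → ℝ) (I : Set ℕ) : MeasurableSpace Ω :=
  ⨆ k ∈ I, MeasurableSpace.comap (ξ k) inferInstance

/-- `ψ(n) = sup_m ψ(σ(ξ 0, …, ξ m), σ(ξ (m + n), ξ (m + n + 1), …))`. -/
def psi {Ω : Type*} [MeasurableSpace Ω] (P : Measure Ω) (ξ : ℕ → Ω → ℝ) (n : ℕ) : ℝ≥0∞ :=
  ⨆ m : ℕ, psiCoeff P (sigmaOf ξ (Set.Icc 0 m)) (sigmaOf ξ (Set.Ici (m + n)))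

/-- The process `ξ` is `ψ`-mixing: `ψ(1) < ∞` and `ψ(n) → 0`. -/
def IsPsiMixing {Ω : Type*} [MeasurableSpace Ω] (P : Measure Ω) (ξ : ℕ → Ω → ℝ) : Prop :=
  psi P ξ 1 < ∞ ∧ Tendsto (psi P ξ) atTop (𝓝 0)

/-- The process `ξ` is (strictly) stationary: the law of the whole path is invariant under
time shifts. -/
def IsStationary {Ω : Type*} [MeasurableSpace Ω] (P : Measure Ω) (ξ : ℕ → Ω → ℝ) : Prop :=
  ∀ k : ℕ, P.map (fun ω n => ξ (n + k) ω) = P.map (fun ω n => ξ n ω)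

/-- The conditions on the times `q 0, …, q (ℓ - 1)`: each is strictly increasing in `n`,
`q 0 n < q 1 n < … < q (ℓ - 1) n` for all `n`, and the gaps between consecutive ones tend to
infinity (no condition when `ℓ = 1`). -/
structure IsReturnTimes {ℓ : ℕ} (q : Fin ℓ → ℕ → ℕ) : Prop where
  strictMono_time : ∀ i, StrictMono (q i)
  strictMono_index : ∀ n, StrictMono (fun i => q i n)
  gap_tendsto : ∀ i j : Fin ℓ, (i : ℕ) + 1 = j →
    Tendsto (fun n => q j n - q i n) atTop atTop

/-- `X_n = ∏ i, 1_Γ(ξ (q i n))`: the indicator of a multiple return to `Γ` at step `n`. -/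
def multiReturn {Ω : Type*} {ℓ : ℕ} (ξ : ℕ → Ω → ℝ) (q : Fin ℓ → ℕ → ℕ) (Γ : Set ℝ)
    (n : ℕ) (ω : Ω) : ℕ :=
  ∏ i : Fin ℓ, Γ.indicator (fun _ => 1) (ξ (q i n) ω)

/-- The hazard time: the first `n ≥ 0` with a multiple return to `Γ` at step `n`, and `∞` if there
is none. -/
def hazard {Ω : Type*} {ℓ : ℕ} (ξ : ℕ → Ω → ℝ) (q : Fin ℓ → ℕ → ℕ) (Γ : Set ℝ) (ω : Ω) : ℕ∞ :=
  ⨅ (n : ℕ) (_ : multiReturn ξ q Γ n ω = 1), (n : ℕ∞)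

/-- `S_M = ∑_{0 ≤ n < M} X_n`: the number of multiple returns to `Δ` before step `M ∈ ℕ ∪ {∞}`,
written as the supremum of the finite partial sums up to `m ≤ M`, so that `S_∞` is the value of the
full series in `ℕ ∪ {∞}`. -/
def returnCount {Ω : Type*} {ℓ : ℕ} (ξ : ℕ → Ω → ℝ) (q : Fin ℓ → ℕ → ℕ) (Δ : Set ℝ)
    (M : ℕ∞) (ω : Ω) : ℕ∞ :=
  ⨆ (m : ℕ) (_ : (m : ℕ∞) ≤ M), ((∑ n ∈ Finset.range m, multiReturn ξ q Δ n ω : ℕ) : ℕ∞)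

/-- `S_τ`: the number of multiple returns to `Δ` before the first multiple return to `Γ`. -/
def returnsUntilHazard {Ω : Type*} {ℓ : ℕ} (ξ : ℕ → Ω → ℝ) (q : Fin ℓ → ℕ → ℕ) (Γ Δ : Set ℝ)
    (ω : Ω) : ℕ∞ :=
  returnCount ξ q Δ (hazard ξ q Γ ω) ω

end MultipleReturns

end

open MultipleReturns

open MultipleReturns

/-! Write `p₀ = Q(Γ)^ℓ`, `p₁ = Q(Δ)^ℓ`. For `B ⊆ ℕ` let `E_n(B)` be the event `survivalSet ξ q Γ Δ B
(Finset.range n)`. When step `n` is added, `E_n(B)` loses the returns to `Γ` and to `Δ` and gains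
the returns to `Δ` from `E_n(B - 1)`. Summing over `n < T` gives an exact balance equation
(`measureReal_survivalSet_eq`).

If a return at step `n` were independent of `E_n(B)` with probability `p₀` or `p₁`, the balance for
`B = {k}` would read `(p₀ + p₁) A_k ≈ p₁ A_{k-1}` and `(p₀ + p₁) A_0 ≈ 1`, where `A_k = ∑_{n<T}
P(E_n({k}))`. Hence `P(S_τ = k) ≈ p₀ A_k ≈ ρ (1 - ρ)^k` with `ρ = p₀ / (p₀ + p₁)`. The time `T ≈ t /
p₀`, with `t` large, makes survival up to `T` unlikely.

Approximate independence, summed over `n < T`, is `exists_abs_returnSet_inter_survivalSet_sub_le`.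
Past steps with a time within `K` of some `q i n` are discarded: their number is bounded, and each
costs `p_D · O(Q(Γ) + Q(Δ))`, where `p_D = Q(D)^ℓ`. The remaining times may lie on both sides of
each `q i n`, so the sites `q i n` are split off one at a time by a two-sided mixing estimate
(`abs_site_inter_sub_le`).

Pointwise convergence becomes convergence in total variation because the geometric tails are
uniformly small (`tendsto_tvDist_geo`). -/

namespace MultipleReturns

/-! ### Consequences of `ψ`-mixing for two and three blocks of times -/

section Mixing

variable {Ω : Type*} {ξ : ℕ → Ω → ℝ}

theorem sigmaOf_le [mΩ : MeasurableSpace Ω] (hξ : ∀ n, Measurable (ξ n)) (I : Set ℕ) :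
    sigmaOf ξ I ≤ mΩ :=
  iSup₂_le fun k _ => (hξ k).comap_le

theorem sigmaOf_mono {I J : Set ℕ} (h : I ⊆ J) : sigmaOf ξ I ≤ sigmaOf ξ J :=
  biSup_mono fun _ hk => h hk

theorem measurableSet_sigmaOf {I : Set ℕ} {k : ℕ} (hk : k ∈ I) {D : Set ℝ}
    (hD : MeasurableSet D) : MeasurableSet[sigmaOf ξ I] (ξ k ⁻¹' D) := by
  have h : MeasurableSpace.comap (ξ k) inferInstance ≤ sigmaOf ξ I :=
    le_iSup₂_of_le k hk le_rfl
  exact h _ ⟨D, hD, rfl⟩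

theorem measurableSet_sigmaOf_forall {ι : Type*} [Countable ι] {I : Set ℕ} (t : ι → ℕ)
    (p : ι → Prop) (ht : ∀ i, p i → t i ∈ I) (D : ι → Set ℝ) (hD : ∀ i, MeasurableSet (D i)) :
    MeasurableSet[sigmaOf ξ I] {ω | ∀ i, p i → ξ (t i) ω ∈ D i} := by
  have h : {ω | ∀ i, p i → ξ (t i) ω ∈ D i} = ⋂ i, ⋂ (_ : p i), ξ (t i) ⁻¹' D i := by
    ext ω
    simp
  rw [h]
  exact MeasurableSet.iInter fun i => MeasurableSet.iInter fun hi =>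
    measurableSet_sigmaOf (ht i hi) (hD i)

variable [MeasurableSpace Ω] {P : Measure Ω} [IsProbabilityMeasure P]

theorem abs_measureReal_inter_sub_le {K : ℕ} {δ : ℝ} (hδ : 0 ≤ δ)
    (hψ : psi P ξ K ≤ ENNReal.ofReal δ) {a : ℕ} {A B : Set Ω}
    (hA : MeasurableSet[sigmaOf ξ {i | i + K ≤ a}] A)
    (hB : MeasurableSet[sigmaOf ξ (Set.Ici a)] B) :
    |P.real (A ∩ B) - P.real A * P.real B| ≤ δ * (P.real A * P.real B) := by
  by_cases hKa : K ≤ a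
  · by_cases h0 : P A * P B = 0
    · have h1 : P.real A * P.real B = 0 := by
        simp only [measureReal_def, ← ENNReal.toReal_mul, h0, ENNReal.toReal_zero]
      have h2 : P.real (A ∩ B) = 0 := by
        rcases mul_eq_zero.1 h1 with h | h
        · exact le_antisymm ((measureReal_mono Set.inter_subset_left).trans h.le)
            measureReal_nonneg
        · exact le_antisymm ((measureReal_mono Set.inter_subset_right).trans h.le)
            measureReal_nonneg
      simp [h1, h2]
    · have hpos : 0 < P.real A * P.real B := by
        have h := mul_ne_zero_iff.1 h0
        exact mul_pos (ENNReal.toReal_pos h.1 (measure_ne_top _ _))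
          (ENNReal.toReal_pos h.2 (measure_ne_top _ _))
      have hA' : MeasurableSet[sigmaOf ξ (Set.Icc 0 (a - K))] A := by
        refine sigmaOf_mono ?_ _ hA
        intro i hi
        simp only [Set.mem_ofPred_eq] at hi
        simp only [Set.mem_Icc]
        omega
      have hB' : MeasurableSet[sigmaOf ξ (Set.Ici (a - K + K))] B := by
        rwa [Nat.sub_add_cancel hKa]
      have h1 : ENNReal.ofReal |P.real (A ∩ B) / (P.real A * P.real B) - 1|
          ≤ ENNReal.ofReal δ := by
        refine le_trans ?_ hψ
        refine le_trans ?_ (le_iSup _ (a - K))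
        exact le_iSup_of_le A (le_iSup_of_le B (le_iSup_of_le hA' (le_iSup_of_le hB'
          (le_iSup_of_le h0 le_rfl))))
      rw [ENNReal.ofReal_le_ofReal_iff hδ] at h1
      have h2 : P.real (A ∩ B) - P.real A * P.real B
          = (P.real (A ∩ B) / (P.real A * P.real B) - 1) * (P.real A * P.real B) := by
        rw [sub_mul, one_mul, div_mul_cancel₀ _ hpos.ne']
      rw [h2, abs_mul, abs_of_pos hpos]
      gcongr
  -- With no time at distance `K` before `a`, the past σ-algebra is trivial and `A` is `∅` or the
  -- whole space.
  · have hI : {i | i + K ≤ a} = (∅ : Set ℕ) := by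
      ext i
      simp only [Set.mem_ofPred_eq, Set.mem_empty_iff_false, iff_false]
      omega
    rw [hI] at hA
    have hbot : sigmaOf ξ ∅ = ⊥ := by simp [sigmaOf]
    rw [hbot, MeasurableSpace.measurableSet_bot_iff] at hA
    rcases hA with rfl | rfl
    · simp
    · simp only [Set.univ_inter, probReal_univ, one_mul, sub_self, abs_zero]
      positivity

/-- A middle site is nearly independent of past and future jointly: both `P(G ∩ A ∩ H)` and `P(A)
P(G ∩ H)` are compared with `w = P(A) P(G) P(H)`. They differ by at most `(3δ + δ²) w ≤ (7/2) δ w`,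
and `w ≤ 2 P(A) P(G ∩ H)` since `δ ≤ 1/2`, whence the factor `7`. -/
theorem abs_three_block_le {K : ℕ} {δ : ℝ} (hδ : 0 ≤ δ) (hδ' : δ ≤ 1 / 2)
    (hψ : psi P ξ K ≤ ENNReal.ofReal δ) {a : ℕ} {G A H : Set Ω}
    (hG : MeasurableSet[sigmaOf ξ {i | i + K ≤ a}] G)
    (hA : MeasurableSet[sigmaOf ξ {a}] A)
    (hH : MeasurableSet[sigmaOf ξ (Set.Ici (a + K))] H) :
    |P.real (A ∩ (G ∩ H)) - P.real A * P.real (G ∩ H)|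
      ≤ 7 * δ * (P.real A * P.real (G ∩ H)) := by
  have hGA : MeasurableSet[sigmaOf ξ {i | i + K ≤ a + K}] (G ∩ A) := by
    refine MeasurableSet.inter (sigmaOf_mono ?_ _ hG) (sigmaOf_mono ?_ _ hA)
    · intro i hi
      simp only [Set.mem_ofPred_eq] at hi ⊢
      omega
    · intro i hi
      simp only [Set.mem_singleton_iff, Set.mem_ofPred_eq] at hi ⊢
      omega
  have h1 := abs_measureReal_inter_sub_le hδ hψ hGA hH
  have h2 := abs_measureReal_inter_sub_le hδ hψ hG
    (sigmaOf_mono (Set.singleton_subset_iff.2 Set.self_mem_Ici) _ hA)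
  have h3 := abs_measureReal_inter_sub_le hδ hψ hG
    (sigmaOf_mono (Set.Ici_subset_Ici.2 (Nat.le_add_right a K)) _ hH)
  have hset : A ∩ (G ∩ H) = G ∩ A ∩ H := by
    ext x
    simp only [Set.mem_inter_iff]
    tauto
  rw [hset]
  set x := P.real (G ∩ A ∩ H)
  set y := P.real (G ∩ A)
  set z := P.real (G ∩ H)
  have hg : 0 ≤ P.real G := measureReal_nonneg
  have ha : 0 ≤ P.real A := measureReal_nonneg
  have hh : 0 ≤ P.real H := measureReal_nonneg
  set g := P.real G
  set b := P.real A
  set h := P.real H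
  have hgh : 0 ≤ g * h := mul_nonneg hg hh
  have hw : 0 ≤ b * (g * h) := mul_nonneg ha hgh
  rw [abs_le] at h1 h2 h3
  have hy : y * h ≤ (1 + δ) * (b * (g * h)) := by nlinarith [mul_le_mul_of_nonneg_right h2.2 hh]
  have hy' : (1 - δ) * (b * (g * h)) ≤ y * h := by
    nlinarith [mul_le_mul_of_nonneg_right h2.1 hh]
  have hz : b * z ≤ (1 + δ) * (b * (g * h)) := by nlinarith [mul_le_mul_of_nonneg_left h3.2 ha]
  have hz' : (1 - δ) * (b * (g * h)) ≤ b * z := by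
    nlinarith [mul_le_mul_of_nonneg_left h3.1 ha]
  set w := b * (g * h)
  have hzw : w ≤ 2 * (b * z) := by nlinarith
  have hx : x ≤ (1 + δ) * ((1 + δ) * w) := by nlinarith
  have hx' : (1 - δ) * ((1 - δ) * w) ≤ x := by nlinarith
  have hδw : 0 ≤ δ * w := mul_nonneg hδ hw
  have hδ2 : δ * (δ * w) ≤ 1 / 2 * (δ * w) := mul_le_mul_of_nonneg_right hδ' hδw
  have hδz : δ * w ≤ δ * (2 * (b * z)) := mul_le_mul_of_nonneg_left hzw hδ
  rw [abs_le]
  constructor <;> nlinarith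

/-- The latest time is split off repeatedly, each split costing a factor `1 + ψ(1) ≤ L`. No gaps
between the times are needed, so this controls the discarded steps. -/
theorem measureReal_forall_mem_le {L : ℝ} (hL : 1 ≤ L)
    (hψ : psi P ξ 1 ≤ ENNReal.ofReal (L - 1)) (D : ℕ → Set ℝ)
    (hD : ∀ k, MeasurableSet (D k)) (U : Finset ℕ) :
    P.real {ω | ∀ k ∈ U, ξ k ω ∈ D k} ≤ ∏ k ∈ U, (L * P.real (ξ k ⁻¹' D k)) := by
  induction U using Finset.induction_on_max with
  | empty => simp
  | insert a s hs ih =>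
    have ha : a ∉ s := fun h => lt_irrefl _ (hs a h)
    have hset : {ω | ∀ k ∈ insert a s, ξ k ω ∈ D k}
        = {ω | ∀ k ∈ s, ξ k ω ∈ D k} ∩ ξ a ⁻¹' D a := by
      ext ω
      simp only [Finset.mem_insert, forall_eq_or_imp, Set.mem_ofPred_eq, Set.mem_inter_iff,
        Set.mem_preimage]
      tauto
    have hmeas : MeasurableSet[sigmaOf ξ {i | i + 1 ≤ a}] {ω | ∀ k ∈ s, ξ k ω ∈ D k} := by
      exact measurableSet_sigmaOf_forall (fun k => k) (fun k => k ∈ s) (fun k hk => hs k hk) D hD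
    have h1 := abs_measureReal_inter_sub_le (sub_nonneg.2 hL) hψ hmeas
      (measurableSet_sigmaOf Set.self_mem_Ici (hD a))
    rw [Finset.prod_insert ha, hset]
    have h2 := (abs_le.1 h1).2
    have h3 : 0 ≤ P.real (ξ a ⁻¹' D a) := measureReal_nonneg
    have h4 := mul_le_mul_of_nonneg_left ih (mul_nonneg (by linarith : 0 ≤ L) h3)
    nlinarith

end Mixing

/-- The set `E` is determined by the values of `Z j`, `j ∈ J`. -/
def DeterminedBy {Ω α : Type*} (Z : ℕ → Ω → α) (J : Set ℕ) (E : Set Ω) : Prop :=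
  ∀ ω ω', (∀ j ∈ J, Z j ω = Z j ω') → (ω ∈ E ↔ ω' ∈ E)

theorem DeterminedBy.mono {Ω α : Type*} {Z : ℕ → Ω → α} {I J : Set ℕ} {E : Set Ω}
    (h : DeterminedBy Z I E) (hIJ : I ⊆ J) : DeterminedBy Z J E :=
  fun ω ω' hj => h ω ω' fun j hi => hj j (hIJ hi)

theorem DeterminedBy.inter {Ω α : Type*} {Z : ℕ → Ω → α} {J : Set ℕ} {E F : Set Ω}
    (hE : DeterminedBy Z J E) (hF : DeterminedBy Z J F) : DeterminedBy Z J (E ∩ F) :=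
  fun ω ω' hj => and_congr (hE ω ω' hj) (hF ω ω' hj)

/-- The natural numbers `a` and `b` are at distance at least `K`. -/
def Separated (K a b : ℕ) : Prop := a + K ≤ b ∨ b + K ≤ a

/-! ### Splitting off single sites from events on both sides -/

section Peeling

variable {Ω : Type*} [MeasurableSpace Ω] {P : Measure Ω} [IsProbabilityMeasure P]
  {ξ : ℕ → Ω → ℝ} {α : Type*} [Finite α] [MeasurableSpace α] [MeasurableSingletonClass α]
  {f : ℝ → α}

theorem measureReal_inter_eq_sum {β : Type*} [Fintype β] {g : Ω → β}
    (hg : ∀ b, MeasurableSet (g ⁻¹' {b})) (E : Set Ω)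
    (hE : ∀ ω ω', g ω = g ω' → (ω ∈ E ↔ ω' ∈ E)) (A : Set Ω) (hA : MeasurableSet A) :
    P.real (A ∩ E) = ∑ b ∈ (Set.toFinite (g '' E)).toFinset, P.real (A ∩ g ⁻¹' {b}) := by
  rw [← measureReal_biUnion_finset]
  · congr 1
    ext ω
    simp only [Set.mem_inter_iff, Set.Finite.mem_toFinset, Set.mem_image, Set.mem_iUnion,
      Set.mem_preimage, Set.mem_singleton_iff, exists_prop]
    constructor
    · rintro ⟨h1, h2⟩
      exact ⟨g ω, ⟨ω, h2, rfl⟩, h1, rfl⟩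
    · rintro ⟨b, ⟨ω', h1, h2⟩, h3, h4⟩
      exact ⟨h3, (hE ω' ω (h2.trans h4.symm)).1 h1⟩
  · intro b _ c _ hbc
    refine Set.disjoint_left.2 fun ω hω hω' => hbc ?_
    exact hω.2.symm.trans hω'.2
  · exact fun b _ => hA.inter (hg b)

/-- `E` need not be a past event intersected with a future one. As `f` has finitely many values, `E`
is a finite disjoint union of atoms that do have this form; the error being relative, the bounds for
the atoms add up. -/
theorem abs_site_inter_sub_le (hξ : ∀ n, Measurable (ξ n)) (hf : Measurable f)
    {K : ℕ} {δ : ℝ} (hδ : 0 ≤ δ) (hδ' : δ ≤ 1 / 2)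
    (hψ : psi P ξ K ≤ ENNReal.ofReal δ) {a : ℕ} {D : Set ℝ} (hD : MeasurableSet D)
    {J : Finset ℕ} (hJ : ∀ j ∈ J, Separated K a j) {E : Set Ω}
    (hE : DeterminedBy (fun j ω => f (ξ j ω)) J E) :
    |P.real (ξ a ⁻¹' D ∩ E) - P.real (ξ a ⁻¹' D) * P.real E|
      ≤ 7 * δ * (P.real (ξ a ⁻¹' D) * P.real E) := by
  classical
  have := Fintype.ofFinite α
  let g : Ω → (J → α) := fun ω j => f (ξ j ω)
  have hgE : ∀ ω ω', g ω = g ω' → (ω ∈ E ↔ ω' ∈ E) := fun ω ω' h =>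
    hE ω ω' fun j hj => congrFun h ⟨j, hj⟩
  have hatom : ∀ b : J → α, g ⁻¹' {b}
      = {ω | ∀ j : J, (j : ℕ) + K ≤ a → ξ j ω ∈ f ⁻¹' {b j}}
        ∩ {ω | ∀ j : J, ¬ (j : ℕ) + K ≤ a → ξ j ω ∈ f ⁻¹' {b j}} := by
    intro b
    ext ω
    simp only [g, Set.mem_preimage, Set.mem_singleton_iff, funext_iff, Set.mem_inter_iff,
      Set.mem_ofPred_eq]
    constructor
    · intro h
      exact ⟨fun j _ => h j, fun j _ => h j⟩
    · rintro ⟨h1, h2⟩ j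
      by_cases hj : (j : ℕ) + K ≤ a
      · exact h1 j hj
      · exact h2 j hj
  have hleft : ∀ b : J → α, MeasurableSet[sigmaOf ξ {i | i + K ≤ a}]
      {ω | ∀ j : J, (j : ℕ) + K ≤ a → ξ j ω ∈ f ⁻¹' {b j}} := by
    intro b
    exact measurableSet_sigmaOf_forall (fun j : J => (j : ℕ)) (fun j => (j : ℕ) + K ≤ a)
      (fun j hj => hj) _ (fun j => hf (measurableSet_singleton (b j)))
  have hright : ∀ b : J → α, MeasurableSet[sigmaOf ξ (Set.Ici (a + K))]
      {ω | ∀ j : J, ¬ (j : ℕ) + K ≤ a → ξ j ω ∈ f ⁻¹' {b j}} := by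
    intro b
    exact measurableSet_sigmaOf_forall (fun j : J => (j : ℕ)) (fun j => ¬ (j : ℕ) + K ≤ a)
      (fun j hj => (hJ j j.2).resolve_right hj) _ (fun j => hf (measurableSet_singleton (b j)))
  have hg : ∀ b, MeasurableSet (g ⁻¹' {b}) := fun b => by
    rw [hatom b]
    exact (sigmaOf_le hξ _ _ (hleft b)).inter (sigmaOf_le hξ _ _ (hright b))
  have hA : MeasurableSet (ξ a ⁻¹' D) := hξ a hD
  have h1 := measureReal_inter_eq_sum (P := P) hg E hgE _ hA
  have h2 := measureReal_inter_eq_sum (P := P) hg E hgE _ MeasurableSet.univ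
  simp only [Set.univ_inter] at h2
  rw [h1, h2, Finset.mul_sum, ← Finset.sum_sub_distrib, Finset.mul_sum]
  refine (Finset.abs_sum_le_sum_abs _ _).trans (Finset.sum_le_sum fun b _ => ?_)
  rw [hatom b]
  exact abs_three_block_le hδ hδ' hψ (hleft b)
    (measurableSet_sigmaOf (Set.mem_singleton a) hD) (hright b)

/-- Induction on the sites: the sites not yet split off join `E` as part of the event determined
away from the current one, so relative errors multiply. -/
theorem abs_sites_inter_sub_le (hξ : ∀ n, Measurable (ξ n)) (hf : Measurable f)
    {K : ℕ} {δ : ℝ} (hδ : 0 ≤ δ) (hδ' : δ ≤ 1 / 2)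
    (hψ : psi P ξ K ≤ ENNReal.ofReal δ) (W : Set α) {p : ℝ}
    (hp : ∀ k, P.real (ξ k ⁻¹' (f ⁻¹' W)) = p)
    {J : Finset ℕ} {E : Set Ω} (hE : DeterminedBy (fun j ω => f (ξ j ω)) J E)
    (s : Finset ℕ) (hs : ∀ a ∈ s, ∀ b ∈ s, a ≠ b → Separated K a b)
    (hsJ : ∀ a ∈ s, ∀ j ∈ J, Separated K a j) :
    |P.real ({ω | ∀ a ∈ s, f (ξ a ω) ∈ W} ∩ E) - p ^ s.card * P.real E|
      ≤ ((1 + 7 * δ) ^ s.card - 1) * (p ^ s.card * P.real E) := by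
  classical
  induction s using Finset.induction_on with
  | empty => simp
  | insert a s ha ih =>
    have ih' := ih (fun b hb c hc => hs b (Finset.mem_insert_of_mem hb) c
      (Finset.mem_insert_of_mem hc)) (fun b hb => hsJ b (Finset.mem_insert_of_mem hb))
    have hset : {ω | ∀ b ∈ insert a s, f (ξ b ω) ∈ W} ∩ E
        = ξ a ⁻¹' (f ⁻¹' W) ∩ ({ω | ∀ b ∈ s, f (ξ b ω) ∈ W} ∩ E) := by
      ext ω
      simp only [Finset.mem_insert, forall_eq_or_imp, Set.mem_ofPred_eq, Set.mem_inter_iff,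
        Set.mem_preimage]
      tauto
    have hdet : DeterminedBy (fun j ω => f (ξ j ω)) ((s ∪ J : Finset ℕ) : Set ℕ)
        ({ω | ∀ b ∈ s, f (ξ b ω) ∈ W} ∩ E) := by
      refine DeterminedBy.inter ?_ (hE.mono (by simp))
      intro ω ω' h
      refine forall₂_congr fun b hb => ?_
      have hb' : f (ξ b ω) = f (ξ b ω') := h b (by simp [hb])
      rw [hb']
    have h1 := abs_site_inter_sub_le hξ hf hδ hδ' hψ (a := a)
      (hf (Set.toFinite W).measurableSet) (J := s ∪ J) ?_ hdet
    · rw [hset, Finset.card_insert_of_notMem ha]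
      rw [hp] at h1
      have hp0 : 0 ≤ p := hp a ▸ measureReal_nonneg
      set x := P.real ({ω | ∀ b ∈ s, f (ξ b ω) ∈ W} ∩ E)
      set y := P.real (ξ a ⁻¹' (f ⁻¹' W) ∩ ({ω | ∀ b ∈ s, f (ξ b ω) ∈ W} ∩ E))
      have hz : p ^ (s.card + 1) * P.real E = p * (p ^ s.card * P.real E) := by ring
      rw [hz]
      set z := p ^ s.card * P.real E
      set r := (1 + 7 * δ) ^ s.card
      have hpow : (1 + 7 * δ) ^ (s.card + 1) = r * (1 + 7 * δ) := pow_succ _ _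
      rw [hpow]
      have hpx := mul_le_mul_of_nonneg_left ih' hp0
      have hx : x ≤ r * z := by linarith [(abs_le.1 ih').2]
      have hx2 := mul_le_mul_of_nonneg_left hx (mul_nonneg (mul_nonneg (by norm_num) hδ) hp0 :
        0 ≤ 7 * δ * p)
      calc |y - p * z| = |(y - p * x) + p * (x - z)| := by ring_nf
        _ ≤ |y - p * x| + |p * (x - z)| := abs_add_le _ _
        _ = |y - p * x| + p * |x - z| := by rw [abs_mul, abs_of_nonneg hp0]
        _ ≤ (r * (1 + 7 * δ) - 1) * (p * z) := by linarith
    · intro j hj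
      rcases Finset.mem_union.1 hj with h | h
      · exact hs a (Finset.mem_insert_self _ _) j (Finset.mem_insert_of_mem h)
          (fun h' => ha (h' ▸ h))
      · exact hsJ a (Finset.mem_insert_self _ _) j h

end Peeling

/-- The event of a multiple return to `D` at step `n`. -/
def returnSet {Ω : Type*} {ℓ : ℕ} (ξ : ℕ → Ω → ℝ) (q : Fin ℓ → ℕ → ℕ) (D : Set ℝ) (n : ℕ) :
    Set Ω :=
  {ω | ∀ i, ξ (q i n) ω ∈ D}

/-- The event that there is no multiple return to `Γ` at the steps in `s` while the number of
multiple returns to `Δ` at these steps lies in `B`. -/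
def survivalSet {Ω : Type*} {ℓ : ℕ} (ξ : ℕ → Ω → ℝ) (q : Fin ℓ → ℕ → ℕ) (Γ Δ : Set ℝ)
    (B : Set ℕ) (s : Finset ℕ) : Set Ω :=
  {ω | ∑ m ∈ s, multiReturn ξ q Δ m ω ∈ B ∧ ∀ m ∈ s, ω ∉ returnSet ξ q Γ m}

/-! ### Return events and the separation of their times -/

section Returns

variable {Ω : Type*} {ξ : ℕ → Ω → ℝ} {ℓ : ℕ} {q : Fin ℓ → ℕ → ℕ}

open Classical in
theorem multiReturn_eq_ite (D : Set ℝ) (n : ℕ) (ω : Ω) :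
    multiReturn ξ q D n ω = if ω ∈ returnSet ξ q D n then 1 else 0 := by
  split_ifs with h
  · exact Finset.prod_eq_one fun i _ => Set.indicator_of_mem (h i) _
  · simp only [returnSet, Set.mem_ofPred_eq, not_forall] at h
    obtain ⟨i, hi⟩ := h
    exact Finset.prod_eq_zero (Finset.mem_univ i) (Set.indicator_of_notMem hi _)

theorem multiReturn_eq_one_iff {D : Set ℝ} {n : ℕ} {ω : Ω} :
    multiReturn ξ q D n ω = 1 ↔ ω ∈ returnSet ξ q D n := by
  rw [multiReturn_eq_ite]
  split_ifs with h <;> simp [h]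

theorem multiReturn_eq_zero {D : Set ℝ} {n : ℕ} {ω : Ω} (h : ω ∉ returnSet ξ q D n) :
    multiReturn ξ q D n ω = 0 := by
  rw [multiReturn_eq_ite, if_neg h]

theorem measurableSet_returnSet [MeasurableSpace Ω] (hξ : ∀ n, Measurable (ξ n)) {D : Set ℝ}
    (hD : MeasurableSet D) (n : ℕ) : MeasurableSet (returnSet ξ q D n) := by
  have h : returnSet ξ q D n = ⋂ i, ξ (q i n) ⁻¹' D := by
    ext ω
    simp [returnSet]
  rw [h]
  exact MeasurableSet.iInter fun i => hξ _ hD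

theorem measurable_multiReturn [MeasurableSpace Ω] (hξ : ∀ n, Measurable (ξ n)) {D : Set ℝ}
    (hD : MeasurableSet D) (n : ℕ) : Measurable (multiReturn ξ q D n) := by
  classical
  have h : multiReturn ξ q D n = fun ω => if ω ∈ returnSet ξ q D n then 1 else 0 :=
    funext fun ω => multiReturn_eq_ite D n ω
  rw [h]
  exact Measurable.ite (measurableSet_returnSet hξ hD n) measurable_const measurable_const

theorem measurableSet_survivalSet [MeasurableSpace Ω] (hξ : ∀ n, Measurable (ξ n)) {Γ Δ : Set ℝ}
    (hΓ : MeasurableSet Γ) (hΔ : MeasurableSet Δ) (B : Set ℕ) (s : Finset ℕ) :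
    MeasurableSet (survivalSet ξ q Γ Δ B s) := by
  have h : survivalSet ξ q Γ Δ B s
      = (fun ω => ∑ m ∈ s, multiReturn ξ q Δ m ω) ⁻¹' B ∩ ⋂ m ∈ s, (returnSet ξ q Γ m)ᶜ := by
    ext ω
    simp [survivalSet]
  rw [h]
  refine MeasurableSet.inter ?_ ?_
  · exact (Finset.measurable_sum s fun m _ => measurable_multiReturn hξ hΔ m)
      (Set.to_countable B).measurableSet
  · exact Finset.measurableSet_biInter _ fun m _ => (measurableSet_returnSet hξ hΓ m).compl

theorem determinedBy_survivalSet (Γ Δ : Set ℝ) (B : Set ℕ) (s : Finset ℕ) :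
    DeterminedBy (fun j ω => ((ξ j ω ∈ Γ, ξ j ω ∈ Δ) : Prop × Prop))
      ((s.biUnion fun m => Finset.univ.image fun i => q i m : Finset ℕ) : Set ℕ)
      (survivalSet ξ q Γ Δ B s) := by
  intro ω ω' h
  have hmem : ∀ m ∈ s, ∀ i, (ξ (q i m) ω ∈ Γ) = (ξ (q i m) ω' ∈ Γ)
      ∧ (ξ (q i m) ω ∈ Δ) = (ξ (q i m) ω' ∈ Δ) := by
    intro m hm i
    refine Prod.mk.inj (h (q i m) ?_)
    simp only [Finset.coe_biUnion, Set.mem_iUnion, Finset.mem_coe, Finset.mem_image,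
      Finset.mem_univ, true_and]
    exact ⟨m, hm, i, rfl⟩
  have hR : ∀ m ∈ s, (ω ∈ returnSet ξ q Γ m ↔ ω' ∈ returnSet ξ q Γ m) := fun m hm =>
    forall_congr' fun i => Eq.to_iff (hmem m hm i).1
  have hR' : ∀ m ∈ s, (ω ∈ returnSet ξ q Δ m ↔ ω' ∈ returnSet ξ q Δ m) := fun m hm =>
    forall_congr' fun i => Eq.to_iff (hmem m hm i).2
  have hsum : ∑ m ∈ s, multiReturn ξ q Δ m ω = ∑ m ∈ s, multiReturn ξ q Δ m ω' :=
    Finset.sum_congr rfl fun m hm => by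
      classical
      rw [multiReturn_eq_ite, multiReturn_eq_ite]
      simp only [hR' m hm]
  refine and_congr (by rw [hsum]) (forall₂_congr fun m hm => not_congr (hR m hm))

theorem mem_survivalSet_filter_iff (Γ Δ : Set ℝ) (B : Set ℕ) (s : Finset ℕ) (p : ℕ → Prop)
    [DecidablePred p] {ω : Ω} (h : ∀ m ∈ s, ¬ p m →
      ω ∉ returnSet ξ q Γ m ∧ ω ∉ returnSet ξ q Δ m) :
    ω ∈ survivalSet ξ q Γ Δ B (s.filter p) ↔ ω ∈ survivalSet ξ q Γ Δ B s := by
  have hsum : ∑ m ∈ s.filter p, multiReturn ξ q Δ m ω = ∑ m ∈ s, multiReturn ξ q Δ m ω := by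
    refine Finset.sum_subset (Finset.filter_subset p s) fun m hm hm' => ?_
    exact multiReturn_eq_zero (h m hm fun hp => hm' (Finset.mem_filter.2 ⟨hm, hp⟩)).2
  refine and_congr (by rw [hsum]) ⟨fun h' m hm => ?_, fun h' m hm => ?_⟩
  · by_cases hp : p m
    · exact h' m (Finset.mem_filter.2 ⟨hm, hp⟩)
    · exact (h m hm hp).1
  · exact h' m (Finset.mem_filter.1 hm).1

/-- For fixed `i`, `j` the injective `q j` sends the close steps into a window of at most `2 * K`
integers around `q i n`. The bound does not depend on `n`. -/
theorem card_filter_not_separated_le (hq : IsReturnTimes q) (K n : ℕ)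
    [DecidablePred fun m => ∀ i j, Separated K (q i n) (q j m)] :
    ((Finset.range n).filter fun m => ¬ ∀ i j, Separated K (q i n) (q j m)).card
      ≤ ℓ * ℓ * (2 * K) := by
  classical
  have hsub : ((Finset.range n).filter fun m => ¬ ∀ i j, Separated K (q i n) (q j m))
      ⊆ (Finset.univ : Finset (Fin ℓ × Fin ℓ)).biUnion fun x =>
        (Finset.range n).filter fun m => ¬ Separated K (q x.1 n) (q x.2 m) := by
    intro m hm
    simp only [Finset.mem_filter, not_forall] at hm
    obtain ⟨hm, i, j, hij⟩ := hm
    exact Finset.mem_biUnion.2 ⟨(i, j), Finset.mem_univ _, Finset.mem_filter.2 ⟨hm, hij⟩⟩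
  refine (Finset.card_le_card hsub).trans ?_
  refine (Finset.card_biUnion_le_card_mul _ _ (2 * K) fun x _ => ?_).trans ?_
  · have hinj := (hq.strictMono_time x.2).injective
    rw [← Finset.card_image_of_injective _ hinj]
    have h : ((Finset.range n).filter fun m => ¬ Separated K (q x.1 n) (q x.2 m)).image (q x.2)
        ⊆ Finset.Ico (q x.1 n - K) (q x.1 n + K) := by
      intro y hy
      obtain ⟨m, hm, rfl⟩ := Finset.mem_image.1 hy
      have := (Finset.mem_filter.1 hm).2
      simp only [Separated] at this
      rw [Finset.mem_Ico]
      omega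
    refine (Finset.card_le_card h).trans ?_
    rw [Nat.card_Ico]
    omega
  · simp

theorem eventually_separated (hq : IsReturnTimes q) (K : ℕ) :
    ∀ᶠ n in atTop, ∀ i j, i ≠ j → Separated K (q i n) (q j n) := by
  have key : ∀ i j : Fin ℓ, i < j → ∀ᶠ n in atTop, q i n + K ≤ q j n := by
    intro i j hij
    have hlt : (i : ℕ) + 1 < ℓ := lt_of_le_of_lt (Nat.succ_le_of_lt hij) j.2
    filter_upwards [(hq.gap_tendsto i ⟨i + 1, hlt⟩ rfl).eventually_ge_atTop K] with n hn
    have h1 : q i n < q ⟨i + 1, hlt⟩ n :=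
      hq.strictMono_index n (Fin.lt_def.2 (Nat.lt_succ_self _))
    have h2 : q ⟨i + 1, hlt⟩ n ≤ q j n :=
      (hq.strictMono_index n).monotone (Fin.le_def.2 (Nat.succ_le_of_lt hij))
    omega
  rw [eventually_all]
  intro i
  rw [eventually_all]
  intro j
  rcases lt_trichotomy i j with h | h | h
  · filter_upwards [key i j h] with n hn _ using Or.inl hn
  · exact Eventually.of_forall fun n hne => absurd h hne
  · filter_upwards [key j i h] with n hn _ using Or.inr hn

theorem returnSet_eq_forall_image (D : Set ℝ) (n : ℕ) :
    returnSet ξ q D n = {ω | ∀ k ∈ Finset.univ.image fun i => q i n, ξ k ω ∈ D} := by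
  ext ω
  simp [returnSet]

theorem card_image_times (hq : IsReturnTimes q) (n : ℕ) :
    (Finset.univ.image fun i => q i n).card = ℓ := by
  rw [Finset.card_image_of_injective _ (hq.strictMono_index n).injective, Finset.card_univ,
    Fintype.card_fin]

end Returns

/-! ### Approximate independence of a return and the past survival event -/

section Error

variable {Ω : Type*} [MeasurableSpace Ω] {P : Measure Ω} [IsProbabilityMeasure P]
  {ξ : ℕ → Ω → ℝ} {ℓ : ℕ} {q : Fin ℓ → ℕ → ℕ} {Q : Measure ℝ}

theorem measureReal_returnSet_le (hq : IsReturnTimes q)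
    (hid : ∀ k D, MeasurableSet D → P.real (ξ k ⁻¹' D) = Q.real D) {L : ℝ} (hL : 1 ≤ L)
    (hψ : psi P ξ 1 ≤ ENNReal.ofReal (L - 1)) {D : Set ℝ} (hD : MeasurableSet D) (n : ℕ) :
    P.real (returnSet ξ q D n) ≤ (L * Q.real D) ^ ℓ := by
  rw [returnSet_eq_forall_image]
  refine (measureReal_forall_mem_le hL hψ (fun _ => D) (fun _ => hD) _).trans_eq ?_
  simp only [hid _ D hD, Finset.prod_const, card_image_times hq]

/-- The times of steps `m` and `n` may overlap, but `q 0 m` precedes all times of step `n`. This one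
new site suffices for the extra small factor. -/
theorem measureReal_returnSet_inter_le (hℓ : 1 ≤ ℓ) (hq : IsReturnTimes q)
    (hid : ∀ k D, MeasurableSet D → P.real (ξ k ⁻¹' D) = Q.real D) {L : ℝ} (hL : 1 ≤ L)
    (hψ : psi P ξ 1 ≤ ENNReal.ofReal (L - 1)) {D D' : Set ℝ} (hD : MeasurableSet D)
    (hD' : MeasurableSet D') {m n : ℕ} (hmn : m < n) :
    P.real (returnSet ξ q D n ∩ returnSet ξ q D' m) ≤ (L * Q.real D) ^ ℓ * (L * Q.real D') := by
  classical
  let i₀ : Fin ℓ := ⟨0, hℓ⟩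
  have hne : ∀ i, q i n ≠ q i₀ m := by
    intro i
    have h1 : q i₀ m < q i₀ n := hq.strictMono_time i₀ hmn
    have h2 : q i₀ n ≤ q i n := (hq.strictMono_index n).monotone (Fin.le_def.2 (Nat.zero_le _))
    omega
  have hnot : q i₀ m ∉ Finset.univ.image fun i => q i n := by
    simp [hne]
  let E : ℕ → Set ℝ := fun k => if k = q i₀ m then D' else D
  have hE : ∀ k, MeasurableSet (E k) := fun k => by
    simp only [E]
    split_ifs
    exacts [hD', hD]
  have hsub : returnSet ξ q D n ∩ returnSet ξ q D' m
      ⊆ {ω | ∀ k ∈ insert (q i₀ m) (Finset.univ.image fun i => q i n), ξ k ω ∈ E k} := by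
    rintro ω ⟨h1, h2⟩ k hk
    rcases Finset.mem_insert.1 hk with rfl | hk
    · simpa [E] using h2 i₀
    · obtain ⟨i, -, rfl⟩ := Finset.mem_image.1 hk
      simpa [E, hne i] using h1 i
  refine (measureReal_mono hsub).trans ((measureReal_forall_mem_le hL hψ E hE _).trans_eq ?_)
  rw [Finset.prod_insert hnot, mul_comm]
  congr 1
  · rw [Finset.prod_congr rfl (g := fun _ => L * Q.real D), Finset.prod_const,
      card_image_times hq n]
    intro k hk
    have : k ≠ q i₀ m := fun h => hnot (h ▸ hk)
    simp only [E, if_neg this, hid k D hD]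
  · simp only [E, if_pos, hid _ D' hD']

theorem abs_measureReal_inter_sub_inter_le {A E F B : Set Ω}
    (h : ∀ ω, ω ∉ B → (ω ∈ E ↔ ω ∈ F)) :
    |P.real (A ∩ E) - P.real (A ∩ F)| ≤ P.real (A ∩ B) := by
  have key : ∀ E F : Set Ω, (∀ ω, ω ∉ B → (ω ∈ E ↔ ω ∈ F)) →
      P.real (A ∩ E) ≤ P.real (A ∩ F) + P.real (A ∩ B) := by
    intro E F h
    refine (measureReal_mono ?_).trans (measureReal_union_le _ _)
    rintro ω ⟨h1, h2⟩
    by_cases hB : ω ∈ B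
    · exact Or.inr ⟨h1, hB⟩
    · exact Or.inl ⟨h1, (h ω hB).1 h2⟩
  rw [abs_le]
  constructor
  · linarith [key F E fun ω hω => (h ω hω).symm]
  · linarith [key E F h]

/-- Crude bound for the finitely many initial steps whose own times are not yet separated. -/
theorem abs_returnSet_inter_sub_le (hq : IsReturnTimes q)
    (hid : ∀ k D, MeasurableSet D → P.real (ξ k ⁻¹' D) = Q.real D) {L : ℝ} (hL : 1 ≤ L)
    (hψ : psi P ξ 1 ≤ ENNReal.ofReal (L - 1)) {D : Set ℝ} (hD : MeasurableSet D) (n : ℕ)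
    (E : Set Ω) :
    |P.real (returnSet ξ q D n ∩ E) - Q.real D ^ ℓ * P.real E| ≤ L ^ ℓ * Q.real D ^ ℓ := by
  have h1 : P.real (returnSet ξ q D n ∩ E) ≤ L ^ ℓ * Q.real D ^ ℓ := by
    rw [← mul_pow]
    exact (measureReal_mono Set.inter_subset_left).trans
      (measureReal_returnSet_le hq hid hL hψ hD n)
  have h2 : 0 ≤ P.real (returnSet ξ q D n ∩ E) := measureReal_nonneg
  have h3 : 0 ≤ Q.real D ^ ℓ := pow_nonneg measureReal_nonneg _
  have h4 : Q.real D ^ ℓ * P.real E ≤ Q.real D ^ ℓ * 1 :=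
    mul_le_mul_of_nonneg_left measureReal_le_one h3
  have h5 : 1 * Q.real D ^ ℓ ≤ L ^ ℓ * Q.real D ^ ℓ :=
    mul_le_mul_of_nonneg_right (one_le_pow₀ hL) h3
  have h6 : 0 ≤ Q.real D ^ ℓ * P.real E := mul_nonneg h3 measureReal_nonneg
  rw [abs_le]
  constructor <;> linarith

/-- Discarding the close steps changes both the joint probability and the product, hence the factor
`2`; what remains is at distance `K` from the times of step `n` and the sites split off with error
`(1 + 7 * δ) ^ ℓ - 1`. -/
theorem abs_returnSet_inter_survivalSet_sub_le [IsProbabilityMeasure Q]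
    (hξ : ∀ n, Measurable (ξ n)) (hℓ : 1 ≤ ℓ) (hq : IsReturnTimes q)
    (hid : ∀ k D, MeasurableSet D → P.real (ξ k ⁻¹' D) = Q.real D) {L : ℝ} (hL : 1 ≤ L)
    (hψ : psi P ξ 1 ≤ ENNReal.ofReal (L - 1)) {K : ℕ} {δ : ℝ} (hδ : 0 ≤ δ) (hδ' : δ ≤ 1 / 2)
    (hψK : psi P ξ K ≤ ENNReal.ofReal δ) {n : ℕ}
    (hn : ∀ i j, i ≠ j → Separated K (q i n) (q j n)) {Γ Δ : Set ℝ} (hΓ : MeasurableSet Γ)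
    (hΔ : MeasurableSet Δ) {D : Set ℝ} (hD : D = Γ ∨ D = Δ) (B : Set ℕ) :
    |P.real (returnSet ξ q D n ∩ survivalSet ξ q Γ Δ B (Finset.range n))
        - Q.real D ^ ℓ * P.real (survivalSet ξ q Γ Δ B (Finset.range n))|
      ≤ Q.real D ^ ℓ * (((1 + 7 * δ) ^ ℓ - 1)
        + 2 * (ℓ * ℓ * (2 * K) : ℕ) * L ^ (ℓ + 1) * (Q.real Γ + Q.real Δ)) := by
  classical
  have hDm : MeasurableSet D := by rcases hD with rfl | rfl <;> assumption
  let far : ℕ → Prop := fun m => ∀ i j, Separated K (q i n) (q j m)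
  set s := (Finset.range n).filter far with hs
  set b := (Finset.range n).filter fun m => ¬ far m with hb
  set E := survivalSet ξ q Γ Δ B (Finset.range n) with hE
  set F := survivalSet ξ q Γ Δ B s with hF
  set bad : Set Ω := ⋃ m ∈ b, (returnSet ξ q Γ m ∪ returnSet ξ q Δ m) with hbad
  have hagree : ∀ ω, ω ∉ bad → (ω ∈ E ↔ ω ∈ F) := by
    intro ω hω
    refine (mem_survivalSet_filter_iff Γ Δ B (Finset.range n) far fun m hm hfar => ?_).symm
    simp only [hbad, Set.mem_iUnion, Set.mem_union, not_exists, not_or] at hω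
    exact hω m (Finset.mem_filter.2 ⟨hm, hfar⟩)
  have hcard : (b.card : ℝ) ≤ (ℓ * ℓ * (2 * K) : ℕ) := by
    exact_mod_cast card_filter_not_separated_le hq K n
  have hL0 : 0 ≤ L := by linarith
  have hx : 0 ≤ Q.real Γ := measureReal_nonneg
  have hy : 0 ≤ Q.real Δ := measureReal_nonneg
  have hpD : 0 ≤ Q.real D ^ ℓ := pow_nonneg measureReal_nonneg _
  have hLl : 0 ≤ L ^ (ℓ + 1) := pow_nonneg hL0 _
  have hbad1 : P.real (returnSet ξ q D n ∩ bad)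
      ≤ (ℓ * ℓ * (2 * K) : ℕ) * (Q.real D ^ ℓ * (L ^ (ℓ + 1) * (Q.real Γ + Q.real Δ))) := by
    have hsub : returnSet ξ q D n ∩ bad ⊆ ⋃ m ∈ b, ((returnSet ξ q D n ∩ returnSet ξ q Γ m)
        ∪ (returnSet ξ q D n ∩ returnSet ξ q Δ m)) := by
      rw [hbad, Set.inter_iUnion₂]
      exact Set.iUnion₂_mono fun m _ => (Set.inter_union_distrib_left _ _ _).subset
    refine (measureReal_mono hsub (measure_ne_top _ _)).trans
      ((measureReal_biUnion_finset_le _ _).trans ?_)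
    refine (Finset.sum_le_card_nsmul _ _
      (Q.real D ^ ℓ * (L ^ (ℓ + 1) * (Q.real Γ + Q.real Δ))) fun m hm => ?_).trans ?_
    · have hmn : m < n := Finset.mem_range.1 (Finset.mem_filter.1 hm).1
      refine (measureReal_union_le _ _).trans ((add_le_add
        (measureReal_returnSet_inter_le hℓ hq hid hL hψ hDm hΓ hmn)
        (measureReal_returnSet_inter_le hℓ hq hid hL hψ hDm hΔ hmn)).trans_eq ?_)
      rw [mul_pow]
      ring
    · rw [nsmul_eq_mul]
      exact mul_le_mul_of_nonneg_right hcard (by positivity)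
  have hbad2 : P.real bad
      ≤ (ℓ * ℓ * (2 * K) : ℕ) * (L ^ (ℓ + 1) * (Q.real Γ + Q.real Δ)) := by
    refine (measureReal_biUnion_finset_le _ _).trans ?_
    refine (Finset.sum_le_card_nsmul _ _
      (L ^ (ℓ + 1) * (Q.real Γ + Q.real Δ)) fun m hm => ?_).trans ?_
    · have hpow : ∀ D : Set ℝ, MeasurableSet D →
          P.real (returnSet ξ q D m) ≤ L ^ (ℓ + 1) * Q.real D := by
        intro D hD
        refine (measureReal_returnSet_le hq hid hL hψ hD m).trans ?_
        rw [mul_pow]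
        refine mul_le_mul (pow_le_pow_right₀ hL (Nat.le_succ ℓ)) ?_
          (pow_nonneg measureReal_nonneg _) hLl
        exact pow_le_of_le_one measureReal_nonneg measureReal_le_one (by omega)
      refine (measureReal_union_le _ _).trans ((add_le_add (hpow Γ hΓ) (hpow Δ hΔ)).trans_eq ?_)
      ring
    · rw [nsmul_eq_mul]
      exact mul_le_mul_of_nonneg_right hcard (by positivity)
  have hfar : |P.real (returnSet ξ q D n ∩ F) - Q.real D ^ ℓ * P.real F|
      ≤ ((1 + 7 * δ) ^ ℓ - 1) * Q.real D ^ ℓ := by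
    let f : ℝ → Prop × Prop := fun x => (x ∈ Γ, x ∈ Δ)
    have hf : Measurable f := (measurable_mem.2 hΓ).prodMk (measurable_mem.2 hΔ)
    -- The four-valued coding `f` records membership in `Γ` and `Δ`, which is all that the survival
    -- event and the return to `D` depend on.
    obtain ⟨W, hW⟩ : ∃ W : Set (Prop × Prop), f ⁻¹' W = D := by
      rcases hD with rfl | rfl
      · exact ⟨{x | x.1}, rfl⟩
      · exact ⟨{x | x.2}, rfl⟩
    have h := abs_sites_inter_sub_le (P := P) hξ hf hδ hδ' hψK W (p := Q.real D)
      (fun k => by rw [hW, hid k D hDm]) (determinedBy_survivalSet (q := q) Γ Δ B s)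
      (Finset.univ.image fun i => q i n) ?_ ?_
    · rw [card_image_times hq] at h
      have hR : {ω | ∀ a ∈ Finset.univ.image fun i => q i n, f (ξ a ω) ∈ W}
          = returnSet ξ q D n := by
        rw [returnSet_eq_forall_image, ← hW]
        rfl
      rw [hR] at h
      refine h.trans (mul_le_mul_of_nonneg_left ?_ ?_)
      · exact mul_le_of_le_one_right hpD measureReal_le_one
      · exact sub_nonneg.2 (one_le_pow₀ (by linarith))
    · intro a ha c hc hac
      obtain ⟨i, -, rfl⟩ := Finset.mem_image.1 ha
      obtain ⟨j, -, rfl⟩ := Finset.mem_image.1 hc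
      exact hn i j fun h => hac (by rw [h])
    · intro a ha c hc
      obtain ⟨i, -, rfl⟩ := Finset.mem_image.1 ha
      obtain ⟨m, hm, hc⟩ := Finset.mem_biUnion.1 hc
      obtain ⟨j, -, rfl⟩ := Finset.mem_image.1 hc
      exact (Finset.mem_filter.1 hm).2 i j
  have h1 := abs_measureReal_inter_sub_inter_le (P := P) (A := returnSet ξ q D n) hagree
  have h2 := abs_measureReal_inter_sub_inter_le (P := P) (A := Set.univ) hagree
  simp only [Set.univ_inter] at h2
  have h3 : |Q.real D ^ ℓ * P.real E - Q.real D ^ ℓ * P.real F|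
      ≤ Q.real D ^ ℓ * ((ℓ * ℓ * (2 * K) : ℕ) * (L ^ (ℓ + 1) * (Q.real Γ + Q.real Δ))) := by
    rw [← mul_sub, abs_mul, abs_of_nonneg hpD]
    exact mul_le_mul_of_nonneg_left (h2.trans hbad2) hpD
  have h4 := h1.trans hbad1
  rw [abs_le] at *
  constructor <;> nlinarith

theorem exists_abs_returnSet_inter_survivalSet_sub_le [IsProbabilityMeasure Q]
    (hξ : ∀ n, Measurable (ξ n))
    (hmix : IsPsiMixing P ξ) (hℓ : 1 ≤ ℓ) (hq : IsReturnTimes q)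
    (hid : ∀ k D, MeasurableSet D → P.real (ξ k ⁻¹' D) = Q.real D) :
    ∀ ε > 0, ∃ c : ℝ, ∀ Γ Δ : Set ℝ, MeasurableSet Γ → MeasurableSet Δ → ∀ D, D = Γ ∨ D = Δ →
      ∀ (B : Set ℕ) (T : ℕ),
      ∑ n ∈ Finset.range T,
        |P.real (returnSet ξ q D n ∩ survivalSet ξ q Γ Δ B (Finset.range n))
          - Q.real D ^ ℓ * P.real (survivalSet ξ q Γ Δ B (Finset.range n))|
        ≤ Q.real D ^ ℓ * (c + T * (ε + c * (Q.real Γ + Q.real Δ))) := by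
  intro ε hε
  obtain ⟨δ, hδ, hδ', hδε⟩ : ∃ δ : ℝ, 0 < δ ∧ δ ≤ 1 / 2 ∧ (1 + 7 * δ) ^ ℓ - 1 ≤ ε := by
    have hcont : Tendsto (fun δ : ℝ => (1 + 7 * δ) ^ ℓ - 1) (𝓝[>] 0) (𝓝 0) := by
      have : Continuous fun δ : ℝ => (1 + 7 * δ) ^ ℓ - 1 := by fun_prop
      have h := this.tendsto 0
      simp only [mul_zero, add_zero, one_pow, sub_self] at h
      exact h.mono_left nhdsWithin_le_nhds
    have h1 := hcont.eventually (eventually_le_nhds hε)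
    have h2 : ∀ᶠ δ : ℝ in 𝓝[>] 0, δ ∈ Set.Ioc (0 : ℝ) (1 / 2) :=
      Ioc_mem_nhdsGT (by norm_num)
    obtain ⟨δ, h3, h4⟩ := (h1.and h2).exists
    exact ⟨δ, h4.1, h4.2, h3⟩
  obtain ⟨K, hK⟩ : ∃ K, psi P ξ K ≤ ENNReal.ofReal δ :=
    (hmix.2.eventually (eventually_le_nhds (ENNReal.ofReal_pos.2 hδ))).exists
  obtain ⟨n₀, hn₀⟩ := eventually_atTop.1 (eventually_separated hq K)
  set L : ℝ := 1 + (psi P ξ 1).toReal with hLdef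
  have hL : 1 ≤ L := by simp [hLdef]
  have hψ : psi P ξ 1 ≤ ENNReal.ofReal (L - 1) := by
    rw [hLdef, add_sub_cancel_left, ENNReal.ofReal_toReal hmix.1.ne]
  set M : ℝ := 2 * (ℓ * ℓ * (2 * K) : ℕ) * L ^ (ℓ + 1) with hM
  have hM0 : 0 ≤ M := by positivity
  -- `n₀ * L ^ ℓ` pays for the initial steps and `M` for the discarded close ones; the sum serves in
  -- both places where `c` occurs.
  refine ⟨n₀ * L ^ ℓ + M, fun Γ Δ hΓ hΔ D hD B T => ?_⟩
  have hDm : MeasurableSet D := by rcases hD with rfl | rfl <;> assumption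
  have hpD : 0 ≤ Q.real D ^ ℓ := pow_nonneg measureReal_nonneg _
  have hQ : 0 ≤ Q.real Γ + Q.real Δ := add_nonneg measureReal_nonneg measureReal_nonneg
  have hLl : 0 ≤ L ^ ℓ := by positivity
  have hterm : ∀ n ∈ Finset.range T,
      |P.real (returnSet ξ q D n ∩ survivalSet ξ q Γ Δ B (Finset.range n))
          - Q.real D ^ ℓ * P.real (survivalSet ξ q Γ Δ B (Finset.range n))|
      ≤ (if n < n₀ then L ^ ℓ * Q.real D ^ ℓ else 0)
        + Q.real D ^ ℓ * (ε + M * (Q.real Γ + Q.real Δ)) := by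
    intro n _
    split_ifs with h
    · refine (abs_returnSet_inter_sub_le hq hid hL hψ hDm n _).trans ?_
      have : 0 ≤ Q.real D ^ ℓ * (ε + M * (Q.real Γ + Q.real Δ)) := by positivity
      linarith
    · rw [zero_add]
      refine (abs_returnSet_inter_survivalSet_sub_le hξ hℓ hq hid hL hψ hδ.le hδ' hK
        (hn₀ n (not_lt.1 h)) hΓ hΔ hD B).trans (mul_le_mul_of_nonneg_left ?_ hpD)
      linarith
  refine (Finset.sum_le_sum hterm).trans ?_
  rw [Finset.sum_add_distrib, Finset.sum_const, Finset.card_range, nsmul_eq_mul,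
    ← Finset.sum_filter, Finset.sum_const, nsmul_eq_mul]
  have hcard : (((Finset.range T).filter fun n => n < n₀).card : ℝ) ≤ n₀ := by
    have h : (Finset.range T).filter (fun n => n < n₀) ⊆ Finset.range n₀ := fun n hn =>
      Finset.mem_range.2 (Finset.mem_filter.1 hn).2
    exact_mod_cast (Finset.card_le_card h).trans_eq (Finset.card_range n₀)
  have h1 := mul_le_mul_of_nonneg_right hcard (mul_nonneg hLl hpD)
  have h2 : 0 ≤ Q.real D ^ ℓ * (M + T * (n₀ * L ^ ℓ * (Q.real Γ + Q.real Δ))) := by positivity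
  linarith

end Error

/-! ### The balance equation and the approximate geometric recursion -/

section Counting

variable {Ω : Type*} {ξ : ℕ → Ω → ℝ} {ℓ : ℕ} {q : Fin ℓ → ℕ → ℕ} {Γ Δ : Set ℝ}

theorem disjoint_returnSet (hℓ : 1 ≤ ℓ) (hdisj : Disjoint Γ Δ) (n : ℕ) :
    Disjoint (returnSet ξ q Γ n) (returnSet ξ q Δ n) :=
  Set.disjoint_left.2 fun _ h h' => Set.disjoint_left.1 hdisj (h ⟨0, hℓ⟩) (h' ⟨0, hℓ⟩)

theorem survivalSet_range_succ (B : Set ℕ) (n : ℕ) (hdisj : Disjoint (returnSet ξ q Γ n)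
    (returnSet ξ q Δ n)) :
    survivalSet ξ q Γ Δ B (Finset.range (n + 1))
      = (survivalSet ξ q Γ Δ B (Finset.range n)
          \ (returnSet ξ q Γ n ∪ returnSet ξ q Δ n))
        ∪ (returnSet ξ q Δ n ∩ survivalSet ξ q Γ Δ (Nat.succ ⁻¹' B) (Finset.range n)) := by
  ext ω
  have hd : ω ∈ returnSet ξ q Γ n → ω ∉ returnSet ξ q Δ n := fun h => Set.disjoint_left.1 hdisj h
  simp only [survivalSet, Finset.range_add_one, Finset.sum_insert Finset.notMem_range_self,
    Finset.forall_mem_insert, Set.mem_ofPred_eq, Set.mem_union, Set.mem_sdiff, Set.mem_inter_iff,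
    Set.mem_preimage, Nat.succ_eq_add_one]
  by_cases h : ω ∈ returnSet ξ q Δ n
  · rw [multiReturn_eq_one_iff.2 h, add_comm 1]
    tauto
  · rw [multiReturn_eq_zero h, zero_add]
    tauto

theorem measureReal_survivalSet_succ [MeasurableSpace Ω] {P : Measure Ω}
    [IsProbabilityMeasure P] (hξ : ∀ n, Measurable (ξ n)) (hΓ : MeasurableSet Γ)
    (hΔ : MeasurableSet Δ) (B : Set ℕ) (n : ℕ)
    (hdisj : Disjoint (returnSet ξ q Γ n) (returnSet ξ q Δ n)) :
    P.real (survivalSet ξ q Γ Δ B (Finset.range (n + 1)))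
      = P.real (survivalSet ξ q Γ Δ B (Finset.range n))
        - P.real (returnSet ξ q Γ n ∩ survivalSet ξ q Γ Δ B (Finset.range n))
        - P.real (returnSet ξ q Δ n ∩ survivalSet ξ q Γ Δ B (Finset.range n))
        + P.real (returnSet ξ q Δ n
          ∩ survivalSet ξ q Γ Δ (Nat.succ ⁻¹' B) (Finset.range n)) := by
  have h0 := measurableSet_returnSet (q := q) hξ hΓ n
  have h1 := measurableSet_returnSet (q := q) hξ hΔ n
  have hS := fun B => measurableSet_survivalSet (q := q) hξ hΓ hΔ B (Finset.range n)
  rw [survivalSet_range_succ B n hdisj, measureReal_union _ (h1.inter (hS _))]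
  · have h2 := measureReal_inter_add_sdiff (μ := P) (s := survivalSet ξ q Γ Δ B (Finset.range n))
      (h0.union h1)
    have h3 : survivalSet ξ q Γ Δ B (Finset.range n) ∩ (returnSet ξ q Γ n ∪ returnSet ξ q Δ n)
        = (returnSet ξ q Γ n ∩ survivalSet ξ q Γ Δ B (Finset.range n))
          ∪ (returnSet ξ q Δ n ∩ survivalSet ξ q Γ Δ B (Finset.range n)) := by
      rw [Set.inter_comm, Set.union_inter_distrib_right]
    rw [h3, measureReal_union (hdisj.mono Set.inter_subset_left Set.inter_subset_left)
      (h1.inter (hS _))] at h2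
    linarith
  · exact Set.disjoint_left.2 fun ω h h' => h.2 (Or.inr h'.1)

theorem measureReal_survivalSet_eq [MeasurableSpace Ω] {P : Measure Ω}
    [IsProbabilityMeasure P] (hξ : ∀ n, Measurable (ξ n)) (hΓ : MeasurableSet Γ)
    (hΔ : MeasurableSet Δ) (hdisj : ∀ n, Disjoint (returnSet ξ q Γ n) (returnSet ξ q Δ n))
    (B : Set ℕ) (T : ℕ) :
    P.real (survivalSet ξ q Γ Δ B (Finset.range T))
      = P.real (survivalSet ξ q Γ Δ B (Finset.range 0))
        - ∑ n ∈ Finset.range T,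
          P.real (returnSet ξ q Γ n ∩ survivalSet ξ q Γ Δ B (Finset.range n))
        - ∑ n ∈ Finset.range T,
          P.real (returnSet ξ q Δ n ∩ survivalSet ξ q Γ Δ B (Finset.range n))
        + ∑ n ∈ Finset.range T, P.real (returnSet ξ q Δ n
          ∩ survivalSet ξ q Γ Δ (Nat.succ ⁻¹' B) (Finset.range n)) := by
  induction T with
  | zero => simp
  | succ n ih =>
    rw [measureReal_survivalSet_succ hξ hΓ hΔ B n (hdisj n), ih]
    simp only [Finset.sum_range_succ]
    ring

theorem survivalSet_range_zero (B : Set ℕ) :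
    survivalSet ξ q Γ Δ B (Finset.range 0) = {_ω | 0 ∈ B} := by
  simp [survivalSet]

theorem survivalSet_mono {B B' : Set ℕ} (h : B ⊆ B') (s : Finset ℕ) :
    survivalSet ξ q Γ Δ B s ⊆ survivalSet ξ q Γ Δ B' s :=
  fun _ hω => ⟨h hω.1, hω.2⟩

theorem survivalSet_univ_anti {s t : Finset ℕ} (h : s ⊆ t) :
    survivalSet ξ q Γ Δ Set.univ t ⊆ survivalSet ξ q Γ Δ Set.univ s :=
  fun _ hω => ⟨Set.mem_univ _, fun m hm => hω.2 m (h hm)⟩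

theorem survivalSet_empty (s : Finset ℕ) : survivalSet ξ q Γ Δ ∅ s = ∅ := by
  simp [survivalSet]

theorem hazard_eq {n : ℕ} {ω : Ω} (h : ω ∈ returnSet ξ q Γ n)
    (h' : ∀ m < n, ω ∉ returnSet ξ q Γ m) : hazard ξ q Γ ω = n := by
  refine le_antisymm (iInf₂_le n (multiReturn_eq_one_iff.2 h)) (le_iInf₂ fun m hm => ?_)
  by_contra hlt
  exact h' m (by exact_mod_cast not_le.1 hlt) (multiReturn_eq_one_iff.1 hm)

theorem returnCount_natCast (n : ℕ) (ω : Ω) :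
    returnCount ξ q Δ n ω = ((∑ m ∈ Finset.range n, multiReturn ξ q Δ m ω : ℕ) : ℕ∞) := by
  refine le_antisymm (iSup₂_le fun m hm => ?_) (le_iSup₂_of_le n le_rfl le_rfl)
  have hmn : m ≤ n := by exact_mod_cast hm
  exact_mod_cast Finset.sum_le_sum_of_subset (Finset.range_mono hmn)

/-- Outside the survival event the hazard time is below `T`, so the count can be read off at the
first return to `Γ`. -/
theorem returnsUntilHazard_eq_iff {T k : ℕ} {ω : Ω}
    (hω : ω ∉ survivalSet ξ q Γ Δ Set.univ (Finset.range T)) :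
    returnsUntilHazard ξ q Γ Δ ω = k ↔
      ω ∈ ⋃ n ∈ Finset.range T,
        (returnSet ξ q Γ n ∩ survivalSet ξ q Γ Δ {k} (Finset.range n)) := by
  classical
  have hex : ∃ m, m < T ∧ ω ∈ returnSet ξ q Γ m := by
    by_contra! h
    exact hω ⟨Set.mem_univ _, fun m hm => h m (Finset.mem_range.1 hm)⟩
  obtain ⟨m, hmT, hm⟩ := hex
  have hex' : ∃ m, ω ∈ returnSet ξ q Γ m := ⟨m, hm⟩
  set n := Nat.find hex'
  have hn : ω ∈ returnSet ξ q Γ n := Nat.find_spec hex'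
  have hn' : ∀ j < n, ω ∉ returnSet ξ q Γ j := fun j hj => Nat.find_min hex' hj
  have hnT : n < T := (Nat.find_min' hex' hm).trans_lt hmT
  rw [returnsUntilHazard, hazard_eq hn hn', returnCount_natCast, Nat.cast_inj]
  simp only [Set.mem_iUnion, Finset.mem_range, Set.mem_inter_iff, exists_prop]
  constructor
  · intro h
    exact ⟨n, hnT, hn, h, fun j hj => hn' j (Finset.mem_range.1 hj)⟩
  · rintro ⟨j, -, hj, hj1, hj2⟩
    have : j = n := by
      refine le_antisymm (not_lt.1 fun h => hj2 n (Finset.mem_range.2 h) hn)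
        (not_lt.1 fun h => hn' j h hj)
    exact this ▸ hj1

theorem borelSpace_enat : BorelSpace ℕ∞ := by
  refine ⟨(eq_top_iff.2 fun s _ => ?_).symm⟩
  let _ : MeasurableSpace ℕ∞ := borel ℕ∞
  have : BorelSpace ℕ∞ := ⟨rfl⟩
  exact s.to_countable.measurableSet

theorem measurable_returnsUntilHazard [MeasurableSpace Ω] (hξ : ∀ n, Measurable (ξ n))
    (hΓ : MeasurableSet Γ) (hΔ : MeasurableSet Δ) :
    Measurable (returnsUntilHazard ξ q Γ Δ) := by
  classical
  have := borelSpace_enat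
  have hhaz : Measurable (hazard ξ q Γ) := by
    refine Measurable.iInf fun n => ?_
    simp only [iInf_eq_if]
    exact Measurable.ite ((measurable_multiReturn hξ hΓ n) (measurableSet_singleton 1))
      measurable_const measurable_const
  refine Measurable.iSup fun m => ?_
  simp only [iSup_eq_if]
  refine Measurable.ite (hhaz (Set.to_countable {x | (m : ℕ∞) ≤ x}).measurableSet) ?_
    measurable_const
  exact (measurable_of_countable fun j : ℕ => (j : ℕ∞)).comp
    (Finset.measurable_sum _ fun n _ => measurable_multiReturn hξ hΔ n)

/-- With `η = v = 0` the relations force `p₀ * A k = ρ (1 - ρ)^k`. In general each step adds at most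
`3 * η + v`, and the inherited error is multiplied by `1 - ρ ≤ 1`, so errors grow only linearly in
`k`. -/
theorem abs_sub_geometric_le {p₀ p₁ η v : ℝ} (hp₀ : 0 < p₀) (hp₁ : 0 < p₁)
    {A G₀ G₁ e : ℕ → ℝ} (hG₀ : ∀ k, |G₀ k - p₀ * A k| ≤ η) (hG₁ : ∀ k, |G₁ k - p₁ * A k| ≤ η)
    (he : ∀ k, 0 ≤ e k ∧ e k ≤ v) (hzero : e 0 = 1 - G₀ 0 - G₁ 0)
    (hsucc : ∀ k, e (k + 1) = G₁ k - G₀ (k + 1) - G₁ (k + 1)) (k : ℕ) :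
    |G₀ k - p₀ / (p₀ + p₁) * (1 - p₀ / (p₀ + p₁)) ^ k| ≤ (k + 1) * (3 * η + v) + η := by
  have hs : 0 < p₀ + p₁ := add_pos hp₀ hp₁
  set ρ := p₀ / (p₀ + p₁) with hρ
  have hρ0 : 0 < ρ := div_pos hp₀ hs
  have hρ1 : ρ ≤ 1 := (div_le_one hs).2 (by linarith)
  have hρs : ρ * (p₀ + p₁) = p₀ := div_mul_cancel₀ _ hs.ne'
  have hη : 0 ≤ η := (abs_nonneg _).trans (hG₀ 0)
  have hv : 0 ≤ v := (he 0).1.trans (he 0).2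
  have hsmall : ∀ x, |x| ≤ 3 * η + v → |ρ * x| ≤ 3 * η + v := by
    intro x hx
    rw [abs_mul, abs_of_pos hρ0]
    exact (mul_le_of_le_one_left (abs_nonneg _) hρ1).trans hx
  have key : |p₀ * A k - ρ * (1 - ρ) ^ k| ≤ (k + 1) * (3 * η + v) := by
    induction k with
    | zero =>
      have h : p₀ * A 0 - ρ * (1 - ρ) ^ 0 = ρ * ((p₀ + p₁) * A 0 - 1) := by
        rw [pow_zero, mul_sub, ← mul_assoc, hρs]
      rw [h, Nat.cast_zero, zero_add, one_mul]
      refine hsmall _ ?_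
      have h0 := abs_le.1 (hG₀ 0)
      have h1 := abs_le.1 (hG₁ 0)
      have h2 := he 0
      rw [abs_le]
      constructor <;> linarith
    | succ k ih =>
      have h : p₀ * A (k + 1) - ρ * (1 - ρ) ^ (k + 1)
          = ρ * ((p₀ + p₁) * A (k + 1) - p₁ * A k)
            + (1 - ρ) * (p₀ * A k - ρ * (1 - ρ) ^ k) := by
        have h' : ρ * p₁ = (1 - ρ) * p₀ := by linarith
        have h'' : ρ * ((p₀ + p₁) * A (k + 1) - p₁ * A k)
            = (ρ * (p₀ + p₁)) * A (k + 1) - (ρ * p₁) * A k := by ring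
        rw [h'', h', hρs]
        ring
      rw [h]
      refine (abs_add_le _ _).trans ?_
      have h1 : |ρ * ((p₀ + p₁) * A (k + 1) - p₁ * A k)| ≤ 3 * η + v := by
        refine hsmall _ ?_
        have h0 := abs_le.1 (hG₀ (k + 1))
        have h1 := abs_le.1 (hG₁ (k + 1))
        have h1' := abs_le.1 (hG₁ k)
        have h2 := he (k + 1)
        have h3 := hsucc k
        rw [abs_le]
        constructor <;> linarith
      have h2 : |(1 - ρ) * (p₀ * A k - ρ * (1 - ρ) ^ k)| ≤ (k + 1) * (3 * η + v) := by
        rw [abs_mul, abs_of_nonneg (by linarith : 0 ≤ 1 - ρ)]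
        exact (mul_le_of_le_one_left (abs_nonneg _) (by linarith)).trans ih
      push_cast
      linarith
  have h1 := abs_le.1 (hG₀ k)
  have h2 := abs_le.1 key
  rw [abs_le]
  constructor <;> linarith

theorem abs_measureReal_returnsUntilHazard_sub_le [MeasurableSpace Ω] {P : Measure Ω}
    [IsProbabilityMeasure P] (hξ : ∀ n, Measurable (ξ n)) (hΓ : MeasurableSet Γ)
    (hΔ : MeasurableSet Δ) (hdisj : ∀ n, Disjoint (returnSet ξ q Γ n) (returnSet ξ q Δ n))
    {p₀ p₁ η t : ℝ} (hp₀ : 0 < p₀) (hp₁ : 0 < p₁) (ht : 0 < t) {T : ℕ} (hT : t ≤ T * p₀)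
    (h₀ : ∀ B, ∑ n ∈ Finset.range T,
      |P.real (returnSet ξ q Γ n ∩ survivalSet ξ q Γ Δ B (Finset.range n))
        - p₀ * P.real (survivalSet ξ q Γ Δ B (Finset.range n))| ≤ η)
    (h₁ : ∀ B, ∑ n ∈ Finset.range T,
      |P.real (returnSet ξ q Δ n ∩ survivalSet ξ q Γ Δ B (Finset.range n))
        - p₁ * P.real (survivalSet ξ q Γ Δ B (Finset.range n))| ≤ η) (k : ℕ) :
    |P.real (returnsUntilHazard ξ q Γ Δ ⁻¹' {(k : ℕ∞)})
        - p₀ / (p₀ + p₁) * (1 - p₀ / (p₀ + p₁)) ^ k| ≤ (k + 2) * (3 * η + (1 + η) / t) := by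
  let A : Set ℕ → ℝ := fun B =>
    ∑ n ∈ Finset.range T, P.real (survivalSet ξ q Γ Δ B (Finset.range n))
  let G : Set ℝ → Set ℕ → ℝ := fun D B =>
    ∑ n ∈ Finset.range T, P.real (returnSet ξ q D n ∩ survivalSet ξ q Γ Δ B (Finset.range n))
  have hG : ∀ (D : Set ℝ) (p : ℝ), (∀ B, ∑ n ∈ Finset.range T,
      |P.real (returnSet ξ q D n ∩ survivalSet ξ q Γ Δ B (Finset.range n))
        - p * P.real (survivalSet ξ q Γ Δ B (Finset.range n))| ≤ η) →
      ∀ B, |G D B - p * A B| ≤ η := by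
    intro D p h B
    simp only [G, A, Finset.mul_sum, ← Finset.sum_sub_distrib]
    exact (Finset.abs_sum_le_sum_abs _ _).trans (h B)
  have hbal : ∀ B, P.real (survivalSet ξ q Γ Δ B (Finset.range T))
      = P.real (survivalSet ξ q Γ Δ B (Finset.range 0)) - G Γ B - G Δ B
        + G Δ (Nat.succ ⁻¹' B) := fun B => measureReal_survivalSet_eq hξ hΓ hΔ hdisj B T
  have hη : 0 ≤ η := (abs_nonneg _).trans (hG Γ p₀ h₀ ∅)
  set v := P.real (survivalSet ξ q Γ Δ Set.univ (Finset.range T)) with hv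
  have hv0 : 0 ≤ v := measureReal_nonneg
  -- For `B = Set.univ` the two `Δ` sums cancel, so `G Γ univ ≤ 1` and `p₀ * A univ ≤ 1 + η`.
  -- Survival probabilities decrease in `n`, so `T * v ≤ A univ`.
  have hvt : v ≤ (1 + η) / t := by
    rw [le_div_iff₀ ht]
    have h1 := hbal Set.univ
    simp only [Set.preimage_univ, survivalSet_range_zero, Set.mem_univ] at h1
    have h2 : (T : ℝ) * v ≤ A Set.univ := by
      have := Finset.card_nsmul_le_sum (Finset.range T)
        (fun n => P.real (survivalSet ξ q Γ Δ Set.univ (Finset.range n))) v fun n hn =>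
          measureReal_mono (survivalSet_univ_anti
            (Finset.range_mono (Finset.mem_range.1 hn).le))
      rwa [Finset.card_range, nsmul_eq_mul] at this
    have h3 := (abs_le.1 (hG Γ p₀ h₀ Set.univ)).1
    have h4 : P.real ({_ω : Ω | True}) ≤ 1 := measureReal_le_one
    have h5 := mul_le_mul_of_nonneg_left h2 hp₀.le
    have h6 := mul_le_mul_of_nonneg_left hT hv0
    linarith
  have hS : |P.real (returnsUntilHazard ξ q Γ Δ ⁻¹' {(k : ℕ∞)}) - G Γ {k}| ≤ v := by
    have hGk : G Γ {k} = P.real (⋃ n ∈ Finset.range T,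
        (returnSet ξ q Γ n ∩ survivalSet ξ q Γ Δ {k} (Finset.range n))) := by
      rw [measureReal_biUnion_finset]
      · intro m _ n _ hmn
        refine Set.disjoint_left.2 fun ω h h' => ?_
        rcases lt_or_gt_of_ne hmn with hlt | hlt
        · exact h'.2.2 m (Finset.mem_range.2 hlt) h.1
        · exact h.2.2 n (Finset.mem_range.2 hlt) h'.1
      · exact fun n _ => (measurableSet_returnSet hξ hΓ n).inter
          (measurableSet_survivalSet hξ hΓ hΔ _ _)
    rw [hGk]
    have h := abs_measureReal_inter_sub_inter_le (P := P) (A := Set.univ)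
      (E := returnsUntilHazard ξ q Γ Δ ⁻¹' {(k : ℕ∞)})
      (F := ⋃ n ∈ Finset.range T,
        (returnSet ξ q Γ n ∩ survivalSet ξ q Γ Δ {k} (Finset.range n)))
      (B := survivalSet ξ q Γ Δ Set.univ (Finset.range T))
      fun ω hω => returnsUntilHazard_eq_iff hω
    simpa only [Set.univ_inter] using h
  have hrec := abs_sub_geometric_le hp₀ hp₁ (A := fun k => A {k}) (G₀ := fun k => G Γ {k})
    (G₁ := fun k => G Δ {k})
    (e := fun k => P.real (survivalSet ξ q Γ Δ {k} (Finset.range T))) (v := v)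
    (fun k => hG Γ p₀ h₀ {k}) (fun k => hG Δ p₁ h₁ {k})
    (fun k => ⟨measureReal_nonneg, measureReal_mono (survivalSet_mono (Set.subset_univ _) _)⟩)
    (by
      have h1 := hbal {0}
      have h2 : Nat.succ ⁻¹' {0} = (∅ : Set ℕ) := by ext; simp
      have h3 : G Δ ∅ = 0 := by simp [G, survivalSet_empty]
      have h4 : survivalSet ξ q Γ Δ {0} (Finset.range 0) = Set.univ := by
        ext; simp [survivalSet]
      rw [h2, h3, h4, probReal_univ] at h1
      linarith)
    (fun k => by
      have h1 := hbal {k + 1}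
      have h2 : Nat.succ ⁻¹' {k + 1} = ({k} : Set ℕ) := by ext; simp
      have h4 : survivalSet ξ q Γ Δ {k + 1} (Finset.range 0) = ∅ := by
        ext; simp [survivalSet]
      rw [h2, h4, measureReal_empty] at h1
      linarith) k
  have h5 : |P.real (returnsUntilHazard ξ q Γ Δ ⁻¹' {(k : ℕ∞)})
      - p₀ / (p₀ + p₁) * (1 - p₀ / (p₀ + p₁)) ^ k| ≤ v + ((k + 1) * (3 * η + v) + η) :=
    (abs_sub_le _ (G Γ {k}) _).trans (add_le_add hS hrec)
  have h6 : ((k : ℝ) + 2) * (3 * η + v) ≤ (k + 2) * (3 * η + (1 + η) / t) := by gcongr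
  linarith

end Counting

/-! ### From point masses to total variation -/

theorem tvDist_nonneg {E : Type*} [MeasurableSpace E] (μ ν : Measure E) : 0 ≤ tvDist μ ν :=
  Real.iSup_nonneg fun _ => abs_nonneg _

/-- The mass of `μ` outside `{0, …, m - 1}`, including any at `∞`, exceeds that of `ν` by at most
the sum of the point differences; so only the tail of `ν` enters. -/
theorem tvDist_le_sum (μ ν : Measure ℕ∞) [IsProbabilityMeasure μ] [IsProbabilityMeasure ν]
    (m : ℕ) :
    tvDist μ ν ≤ 2 * ∑ k ∈ Finset.range m, |μ.real {(k : ℕ∞)} - ν.real {(k : ℕ∞)}|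
      + 2 * (1 - ∑ k ∈ Finset.range m, ν.real {(k : ℕ∞)}) := by
  classical
  have : Nonempty {G : Set ℕ∞ // MeasurableSet G} := ⟨⟨∅, MeasurableSet.empty⟩⟩
  refine ciSup_le fun ⟨G, hG⟩ => ?_
  let e : ℕ ↪ ℕ∞ := ⟨fun k => (k : ℕ∞), Nat.cast_injective⟩
  have hsum : ∀ (μ : Measure ℕ∞) [IsProbabilityMeasure μ] (s : Finset ℕ),
      μ.real (s.map e : Finset ℕ∞) = ∑ k ∈ s, μ.real {(k : ℕ∞)} := by
    intro μ _ s
    rw [← sum_measureReal_singleton, Finset.sum_map]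
    rfl
  set F : Set ℕ∞ := (((Finset.range m).map e : Finset ℕ∞) : Set ℕ∞) with hF
  have hFm : MeasurableSet F := Finset.measurableSet _
  have hGF : G ∩ F = (((Finset.range m).filter fun k : ℕ => (k : ℕ∞) ∈ G).map e :
      Finset ℕ∞) := by
    ext x
    simp only [hF, Set.mem_inter_iff, Finset.coe_map, Set.mem_image, Finset.mem_coe,
      Finset.mem_range, Finset.mem_filter]
    constructor
    · rintro ⟨h, k, hk, rfl⟩
      exact ⟨k, ⟨hk, h⟩, rfl⟩
    · rintro ⟨k, ⟨hk, h⟩, rfl⟩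
      exact ⟨h, k, hk, rfl⟩
  set d := ∑ k ∈ Finset.range m, |μ.real {(k : ℕ∞)} - ν.real {(k : ℕ∞)}| with hd
  have h1 : |μ.real (G ∩ F) - ν.real (G ∩ F)| ≤ d := by
    rw [hGF, hsum, hsum, ← Finset.sum_sub_distrib]
    refine (Finset.abs_sum_le_sum_abs _ _).trans ?_
    exact Finset.sum_le_sum_of_subset_of_nonneg (Finset.filter_subset _ _)
      fun _ _ _ => abs_nonneg _
  have h2 : |μ.real F - ν.real F| ≤ d := by
    rw [hF, hsum, hsum, ← Finset.sum_sub_distrib]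
    exact Finset.abs_sum_le_sum_abs _ _
  have hdiff : ∀ (μ : Measure ℕ∞) [IsProbabilityMeasure μ],
      0 ≤ μ.real (G \ F) ∧ μ.real (G \ F) ≤ 1 - μ.real F := by
    intro μ _
    rw [← probReal_compl_eq_one_sub hFm]
    exact ⟨measureReal_nonneg, measureReal_mono (fun x hx => hx.2)⟩
  have h3 := measureReal_inter_add_sdiff (μ := μ) (s := G) hFm
  have h4 := measureReal_inter_add_sdiff (μ := ν) (s := G) hFm
  have h5 := hdiff μ
  have h6 := hdiff ν
  have h7 : ν.real F = ∑ k ∈ Finset.range m, ν.real {(k : ℕ∞)} := hsum ν _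
  rw [← h7]
  change |μ.real G - ν.real G| ≤ _
  rw [abs_le] at *
  constructor <;> linarith

theorem geo_real_singleton {ρ : ℝ} (h0 : 0 < ρ) (h1 : ρ < 1) (k : ℕ) :
    (geo ρ).real {(k : ℕ∞)} = ρ * (1 - ρ) ^ k := by
  rw [measureReal_def, geo_singleton h0 h1, ENNReal.toReal_ofReal]
  exact mul_nonneg h0.le (pow_nonneg (by linarith) _)

theorem one_sub_sum_geo {ρ : ℝ} (h0 : 0 < ρ) (h1 : ρ < 1) (m : ℕ) :
    1 - ∑ k ∈ Finset.range m, (geo ρ).real {(k : ℕ∞)} = (1 - ρ) ^ m := by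
  simp only [geo_real_singleton h0 h1, ← Finset.mul_sum]
  have h := mul_neg_geom_sum (1 - ρ) m
  rw [sub_sub_cancel] at h
  rw [h, sub_sub_cancel]

/-- The lower bound `r` makes the tails `(1 - ρ N) ^ m ≤ (1 - r) ^ m` small uniformly in `N`, so one
cutoff `m` serves for all `N`. -/
theorem tendsto_tvDist_geo {μ : ℕ → Measure ℕ∞} [∀ N, IsProbabilityMeasure (μ N)] {ρ : ℕ → ℝ}
    {r : ℝ} (hr : 0 < r) (hρ : ∀ N, r ≤ ρ N) (hρ1 : ∀ N, ρ N < 1)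
    (h : ∀ k : ℕ, Tendsto (fun N => (μ N).real {(k : ℕ∞)} - ρ N * (1 - ρ N) ^ k) atTop (𝓝 0)) :
    Tendsto (fun N => tvDist (μ N) (geo (ρ N))) atTop (𝓝 0) := by
  have hr1 : r < 1 := (hρ 0).trans_lt (hρ1 0)
  rw [Metric.tendsto_atTop']
  intro ε hε
  obtain ⟨m, hm⟩ : ∃ m : ℕ, (1 - r) ^ m < ε / 4 :=
    exists_pow_lt_of_lt_one (by linarith) (by linarith)
  have hsum : Tendsto (fun N => ∑ k ∈ Finset.range m,
      |(μ N).real {(k : ℕ∞)} - ρ N * (1 - ρ N) ^ k|) atTop (𝓝 0) := by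
    have := tendsto_finsetSum (Finset.range m) fun k _ => (h k).abs
    simpa using this
  obtain ⟨N₀, hN₀⟩ := eventually_atTop.1
    (hsum.eventually (eventually_lt_nhds (show (0 : ℝ) < ε / 4 by linarith)))
  refine ⟨N₀, fun N hN => ?_⟩
  have hpos : 0 < ρ N := hr.trans_le (hρ N)
  rw [Real.dist_eq, sub_zero, abs_of_nonneg (tvDist_nonneg _ _)]
  refine (tvDist_le_sum (μ N) (geo (ρ N)) m).trans_lt ?_
  rw [one_sub_sum_geo hpos (hρ1 N)]
  simp only [geo_real_singleton hpos (hρ1 N)]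
  have h1 := hN₀ N hN.le
  have h2 : (1 - ρ N) ^ m ≤ (1 - r) ^ m :=
    pow_le_pow_left₀ (by linarith [hρ1 N]) (by linarith [hρ N]) m
  linarith

/-! ### Choice of parameters and the limit of each point mass -/

theorem tendsto_measureReal_returnsUntilHazard {Ω : Type*} [MeasurableSpace Ω] {P : Measure Ω}
    [IsProbabilityMeasure P] {ξ : ℕ → Ω → ℝ} {ℓ : ℕ} {q : Fin ℓ → ℕ → ℕ} {Q : Measure ℝ}
    [IsProbabilityMeasure Q] (hξ : ∀ n, Measurable (ξ n))
    (hmix : IsPsiMixing P ξ) (hℓ : 1 ≤ ℓ) (hq : IsReturnTimes q)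
    (hid : ∀ k D, MeasurableSet D → P.real (ξ k ⁻¹' D) = Q.real D)
    {Γ Δ : ℕ → Set ℝ} (hΓ : ∀ N, MeasurableSet (Γ N)) (hΔ : ∀ N, MeasurableSet (Δ N))
    (hdisj : ∀ N, Disjoint (Γ N) (Δ N))
    (hΓpos : ∀ N, 0 < Q.real (Γ N)) (hΔpos : ∀ N, 0 < Q.real (Δ N))
    (hΓ0 : Tendsto (fun N => Q.real (Γ N)) atTop (𝓝 0))
    (hΔ0 : Tendsto (fun N => Q.real (Δ N)) atTop (𝓝 0))
    {C : ℝ} (hC : 1 ≤ C) (hratio : ∀ N, Q.real (Δ N) ≤ C * Q.real (Γ N)) (k : ℕ) :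
    Tendsto (fun N => P.real (returnsUntilHazard ξ q (Γ N) (Δ N) ⁻¹' {(k : ℕ∞)})
      - Q.real (Γ N) ^ ℓ / (Q.real (Γ N) ^ ℓ + Q.real (Δ N) ^ ℓ)
        * (1 - Q.real (Γ N) ^ ℓ / (Q.real (Γ N) ^ ℓ + Q.real (Δ N) ^ ℓ)) ^ k)
      atTop (𝓝 0) := by
  rw [Metric.tendsto_atTop']
  intro ε hε
  have hk : (0 : ℝ) < k + 2 := by positivity
  obtain ⟨κ, hκ0, hκε⟩ : ∃ κ : ℝ, 0 < κ ∧ (k + 2) * (2 * κ) < ε :=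
    ⟨ε / (4 * (k + 2)), by positivity, by
      have : ((k : ℝ) + 2) * (2 * (ε / (4 * (k + 2)))) = ε / 2 := by
        field_simp
        norm_num
      linarith⟩
  obtain ⟨η, hη0, hη1, hηκ⟩ : ∃ η : ℝ, 0 < η ∧ η ≤ 1 ∧ 3 * η ≤ κ :=
    ⟨min 1 (κ / 3), by positivity, min_le_left _ _, by linarith [min_le_right 1 (κ / 3)]⟩
  obtain ⟨t, ht0, htκ⟩ : ∃ t : ℝ, 0 < t ∧ 2 / t ≤ κ :=
    ⟨2 / κ, by positivity, by rw [div_div_cancel₀ two_ne_zero]⟩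
  have hCl : 1 ≤ C ^ ℓ := one_le_pow₀ hC
  -- Since `T * Q(Γ)^ℓ ≈ t` and `Q(D)^ℓ ≤ C^ℓ Q(Γ)^ℓ`, the total error tends to at most `C^ℓ * t`
  -- times this accuracy, that is `η / 2`.
  obtain ⟨c, hc⟩ := exists_abs_returnSet_inter_survivalSet_sub_le (Q := Q) hξ hmix hℓ hq hid
    (η / (2 * C ^ ℓ * t)) (by positivity)
  set x : ℝ := η / (2 * C ^ ℓ * t) with hx
  have hlim : Tendsto (fun N => C ^ ℓ * (Q.real (Γ N) ^ ℓ * |c| + (t + Q.real (Γ N) ^ ℓ)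
      * (x + |c| * (Q.real (Γ N) + Q.real (Δ N))))) atTop
      (𝓝 (C ^ ℓ * (0 ^ ℓ * |c| + (t + 0 ^ ℓ) * (x + |c| * (0 + 0))))) :=
    (((hΓ0.pow ℓ).mul_const _).add (((hΓ0.pow ℓ).const_add t).mul
      (((hΓ0.add hΔ0).const_mul _).const_add x))).const_mul _
  have hval : C ^ ℓ * (0 ^ ℓ * |c| + (t + 0 ^ ℓ) * (x + |c| * (0 + 0))) = η / 2 := by
    rw [zero_pow (by omega), hx]
    field_simp
    ring
  rw [hval] at hlim
  obtain ⟨N₀, hN₀⟩ := eventually_atTop.1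
    (hlim.eventually (eventually_lt_nhds (show η / 2 < η by linarith)))
  refine ⟨N₀, fun N hN => ?_⟩
  have hbound := hN₀ N hN.le
  set a := Q.real (Γ N) with ha
  set b := Q.real (Δ N) with hb
  have ha0 : 0 < a := hΓpos N
  have hb0 : 0 < b := hΔpos N
  have hal : 0 < a ^ ℓ := pow_pos ha0 ℓ
  set T := ⌈t / a ^ ℓ⌉₊ with hT
  have hT1 : t ≤ T * a ^ ℓ := (div_le_iff₀ hal).1 (Nat.le_ceil _)
  have hT2 : a ^ ℓ * T ≤ t + a ^ ℓ := by
    have := (Nat.ceil_lt_add_one (div_pos ht0 hal).le).le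
    have h := mul_le_mul_of_nonneg_left this hal.le
    rw [mul_add, mul_one, mul_div_cancel₀ _ hal.ne'] at h
    exact h
  have hx0 : 0 < x := by positivity
  have herr : ∀ D, D = Γ N ∨ D = Δ N → ∀ B, ∑ n ∈ Finset.range T,
      |P.real (returnSet ξ q D n ∩ survivalSet ξ q (Γ N) (Δ N) B (Finset.range n))
        - Q.real D ^ ℓ * P.real (survivalSet ξ q (Γ N) (Δ N) B (Finset.range n))| ≤ η := by
    intro D hD B
    refine (hc (Γ N) (Δ N) (hΓ N) (hΔ N) D hD B T).trans (le_trans ?_ hbound.le)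
    have hDle : Q.real D ^ ℓ ≤ C ^ ℓ * a ^ ℓ := by
      rw [← mul_pow]
      refine pow_le_pow_left₀ measureReal_nonneg ?_ ℓ
      rcases hD with rfl | rfl
      · exact le_mul_of_one_le_left ha0.le hC
      · exact hratio N
    have hcc : c ≤ |c| := le_abs_self c
    calc Q.real D ^ ℓ * (c + T * (x + c * (a + b)))
        ≤ Q.real D ^ ℓ * (|c| + T * (x + |c| * (a + b))) := by gcongr
      _ ≤ C ^ ℓ * a ^ ℓ * (|c| + T * (x + |c| * (a + b))) := by gcongr
      _ = C ^ ℓ * (a ^ ℓ * |c| + a ^ ℓ * T * (x + |c| * (a + b))) := by ring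
      _ ≤ C ^ ℓ * (a ^ ℓ * |c| + (t + a ^ ℓ) * (x + |c| * (a + b))) := by gcongr
  have hmain := abs_measureReal_returnsUntilHazard_sub_le (q := q) hξ (hΓ N) (hΔ N)
    (disjoint_returnSet hℓ (hdisj N)) hal (pow_pos hb0 ℓ) ht0 hT1 (herr _ (Or.inl rfl))
    (herr _ (Or.inr rfl)) k
  rw [Real.dist_eq, sub_zero]
  refine hmain.trans_lt (lt_of_le_of_lt ?_ hκε)
  have h1 : (1 + η) / t ≤ 2 / t := by
    gcongr
    linarith
  exact mul_le_mul_of_nonneg_left (by linarith) hk.le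

end MultipleReturns

/-! ### The two limit statements -/

theorem corollary2p2 {Ω : Type*} [MeasurableSpace Ω] (P : Measure Ω) [IsProbabilityMeasure P]
    (ξ : ℕ → Ω → ℝ) (hξ : ∀ n, Measurable (ξ n))
    (hstat : IsStationary P ξ) (hmix : IsPsiMixing P ξ)
    (ℓ : ℕ) (hℓ : 1 ≤ ℓ) (q : Fin ℓ → ℕ → ℕ) (hq : IsReturnTimes q)
    (Q : Measure ℝ) (hQ : Q = P.map (ξ 0))
    (Γ Δ : ℕ → Set ℝ) (hΓ : ∀ N, MeasurableSet (Γ N)) (hΔ : ∀ N, MeasurableSet (Δ N))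
    (hdisj : ∀ N, Disjoint (Γ N) (Δ N))
    (hΓpos : ∀ N, 0 < Q.real (Γ N)) (hΔpos : ∀ N, 0 < Q.real (Δ N))
    (hΓ0 : Tendsto (fun N => Q.real (Γ N)) atTop (𝓝 0))
    (hΔ0 : Tendsto (fun N => Q.real (Δ N)) atTop (𝓝 0))
    (C : ℝ) (hC : 0 < C)
    (hratio : ∀ N, C⁻¹ ≤ Q.real (Γ N) / Q.real (Δ N) ∧ Q.real (Γ N) / Q.real (Δ N) ≤ C) :
    Tendsto (fun N => tvDist (P.map (returnsUntilHazard ξ q (Γ N) (Δ N)))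
        (geo (Q.real (Γ N) ^ ℓ / (Q.real (Γ N) ^ ℓ + Q.real (Δ N) ^ ℓ)))) atTop (𝓝 0) ∧
    ∀ lam : ℝ, Tendsto (fun N => Q.real (Δ N) / Q.real (Γ N)) atTop (𝓝 lam) →
      Tendsto (fun N => tvDist (P.map (returnsUntilHazard ξ q (Γ N) (Δ N)))
        (geo (1 + lam ^ ℓ)⁻¹)) atTop (𝓝 0) := by
  have hQprob : IsProbabilityMeasure Q := by
    rw [hQ]
    exact Measure.isProbabilityMeasure_map (hξ 0).aemeasurable
  have hid : ∀ k D, MeasurableSet D → P.real (ξ k ⁻¹' D) = Q.real D := by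
    intro k D hD
    have hpath : ∀ j, Measurable fun ω n => ξ (n + j) ω := fun j =>
      measurable_pi_lambda _ fun n => hξ (n + j)
    have h := congrArg (Measure.map fun x : ℕ → ℝ => x 0) (hstat k)
    rw [Measure.map_map (measurable_pi_apply 0) (hpath k),
      Measure.map_map (measurable_pi_apply 0) (show Measurable fun ω n => ξ n ω from hpath 0)] at h
    simp only [Function.comp_def, zero_add] at h
    rw [hQ, ← h, map_measureReal_apply (hξ k) hD]
  have hC1 : 1 ≤ C := by
    have h := (hratio 0).1.trans (hratio 0).2
    rw [inv_le_iff_one_le_mul₀ hC] at h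
    nlinarith
  have hΔΓ : ∀ N, Q.real (Δ N) ≤ C * Q.real (Γ N) := by
    intro N
    have h := (hratio N).1
    rwa [inv_le_iff_one_le_mul₀ hC, mul_comm, ← mul_div_assoc, le_div_iff₀ (hΔpos N), one_mul] at h
  have hmeas : ∀ N, Measurable (returnsUntilHazard ξ q (Γ N) (Δ N)) := fun N =>
    measurable_returnsUntilHazard hξ (hΓ N) (hΔ N)
  have hprob : ∀ N, IsProbabilityMeasure (P.map (returnsUntilHazard ξ q (Γ N) (Δ N))) :=
    fun N => Measure.isProbabilityMeasure_map (hmeas N).aemeasurable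
  have hpoint : ∀ k : ℕ, Tendsto (fun N =>
      (P.map (returnsUntilHazard ξ q (Γ N) (Δ N))).real {(k : ℕ∞)}
      - Q.real (Γ N) ^ ℓ / (Q.real (Γ N) ^ ℓ + Q.real (Δ N) ^ ℓ)
        * (1 - Q.real (Γ N) ^ ℓ / (Q.real (Γ N) ^ ℓ + Q.real (Δ N) ^ ℓ)) ^ k)
      atTop (𝓝 0) := by
    intro k
    simp only [map_measureReal_apply (hmeas _) (measurableSet_singleton _)]
    exact tendsto_measureReal_returnsUntilHazard hξ hmix hℓ hq hid hΓ hΔ hdisj hΓpos hΔpos hΓ0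
      hΔ0 hC1 hΔΓ k
  have hρ : ∀ N, Q.real (Γ N) ^ ℓ / (Q.real (Γ N) ^ ℓ + Q.real (Δ N) ^ ℓ)
      = (1 + (Q.real (Δ N) / Q.real (Γ N)) ^ ℓ)⁻¹ := by
    intro N
    have h1 := pow_pos (hΓpos N) ℓ
    have h2 := pow_pos (hΔpos N) ℓ
    rw [div_pow]
    field_simp
  refine ⟨?_, fun lam hlam => ?_⟩
  -- The ratio bound `Q(Δ) ≤ C Q(Γ)` keeps the geometric parameters away from `0`.
  · refine tendsto_tvDist_geo (r := (1 + C ^ ℓ)⁻¹) (by positivity) (fun N => ?_) (fun N => ?_)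
      hpoint
    · rw [hρ]
      have := hΓpos N
      have := hΔpos N
      have h : Q.real (Δ N) / Q.real (Γ N) ≤ C := (div_le_iff₀ (hΓpos N)).2 (hΔΓ N)
      gcongr
    · have h1 := pow_pos (hΓpos N) ℓ
      have h2 := pow_pos (hΔpos N) ℓ
      rw [div_lt_one (by positivity)]
      linarith
  -- The ratios are at least `C⁻¹`, so the limit is positive and the limiting parameter is below
  -- `1`.
  · have hlam0 : 0 < lam := by
      refine lt_of_lt_of_le (inv_pos.2 hC) (ge_of_tendsto' hlam fun N => ?_)
      have h := inv_anti₀ (div_pos (hΓpos N) (hΔpos N)) (hratio N).2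
      rwa [inv_div] at h
    have hlim : Tendsto (fun N => Q.real (Γ N) ^ ℓ / (Q.real (Γ N) ^ ℓ + Q.real (Δ N) ^ ℓ)) atTop
        (𝓝 (1 + lam ^ ℓ)⁻¹) := by
      simp only [hρ]
      exact ((hlam.pow ℓ).const_add 1).inv₀ (by positivity)
    refine tendsto_tvDist_geo (ρ := fun _ => (1 + lam ^ ℓ)⁻¹) (r := (1 + lam ^ ℓ)⁻¹)
      (by positivity) (fun _ => le_rfl) (fun _ => ?_) fun k => ?_
    · exact inv_lt_one_of_one_lt₀ (by linarith [pow_pos hlam0 ℓ])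
    -- Point masses depend continuously on the parameter, so the varying parameter may be replaced
    -- by its limit.
    · have h1 := (hlim.mul ((hlim.const_sub 1).pow k)).sub_const
        ((1 + lam ^ ℓ)⁻¹ * (1 - (1 + lam ^ ℓ)⁻¹) ^ k)
      rw [sub_self] at h1
      have h2 := (hpoint k).add h1
      simpa using h2
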